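/- Let $G=\prod_{j\in\mathbb N} Z_2$ be the Walsh (dyadic) group, i.e. the set of all sequences $x=(x_0,x_1,\dots)$ with $x_j\in Z_2=\{0,1\}$ under coordinatewise addition modulo $2$, with normalized Haar measure $\mu$. For $n\in\mathbb N=\{0,1,2,\dots\}$ let $\zeta_n$ be the $\sigma$-algebra generated by the dyadic intervals $I_n(x)=\{y\in G: y_0=x_0,\dots,y_{n-1}=x_{n-1}\}$, $x\in G$. For $n=\sum_j n_j2^j$ with $n_j\in\{0,1\}$ let $w_n(x)=\prod_{j}(-1)^{n_jx_j}$ be the $n$-th Walsh function. For a real martingale $F=(F_n)_{n\in\mathbb N}$ with respect to $(\zeta_n)_{n\in\mathbb N}$ put $$\widehat F(k)=\lim_{n\to\infty}\int_G F_n w_k\,d\mu,\qquad S_nF=\sum_{k=0}^{n-1}\widehat F(k)w_k,\qquad \sigma_nF=\frac1n\sum_{k=1}^{n}S_kF\quad(n\ge 1),$$ $\|f\|_{1/2}=\left(\int_G|f|^{1/2}\,d\mu\right)^{2}$ and $\|F\|_{H_{1/2}}=\left\|\sup_{n\in\mathbb N}|F_n|\right\|_{1/2}$. The martingale Hardy space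 $H_{1/2}(G)$ consists of all such $F$ with $\|F\|_{H_{1/2}}<\infty$. For $s\in\mathbb N$ and $0\le k\le s-1$ let $\beta_k^s=2^s+2^{s-1}+\dots+2^k$. Then the restricted maximal operator $$\tilde\sigma_5^{*,\nabla}F:=\sup_{s\in\mathbb N}\ \sup_{0\le k\le s-1}\frac{|\sigma_{\beta_k^s}F|}{\log^2\beta_k^s}$$ is bounded from $H_{1/2}(G)$ to $L_{1/2}(G)$: there is an absolute constant $C<\infty$ such that for every $F\in H_{1/2}(G)$ one has $\tilde\sigma_5^{*,\nabla}F\in L_{1/2}(G)$ and $$\left\|\tilde\sigma_5^{*,\nabla}F\right\|_{1/2}\le C\,\|F\|_{H_{1/2}}.$$ -/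

import Mathlib

open MeasureTheory Filter
open scoped ENNReal NNReal

namespace WalshFejer

noncomputable section

/-- The Walsh (dyadic) group: the complete direct product of countably many copies of `Z_2`. -/
abbrev G : Type := ℕ → ZMod 2

/-- The Haar measure of `Z_2`, giving mass `1/2` to each of the two singletons. -/
def muZ2 : Measure (ZMod 2) :=
  (2⁻¹ : ℝ≥0∞) • (Measure.dirac 0 + Measure.dirac 1)

instance : IsProbabilityMeasure muZ2 := by
  constructor
  simp [muZ2, ENNReal.inv_two_add_inv_two]

/-- The normalized Haar measure on `G`: the product of the Haar measures of the factors. -/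
def haar : Measure G := Measure.infinitePi (fun _ : ℕ => muZ2)

instance : IsProbabilityMeasure haar := by
  unfold haar
  infer_instance

/-- The dyadic interval `I_n(x)`: all `y ∈ G` with `y_0 = x_0, …, y_{n-1} = x_{n-1}`. -/
def dyadicInterval (n : ℕ) (x : G) : Set G := {y | ∀ i, i < n → y i = x i}

theorem measurableSet_dyadicInterval (n : ℕ) (x : G) :
    MeasurableSet (dyadicInterval n x) := by
  have h : dyadicInterval n x = ⋂ i ∈ Set.Iio n, (fun y : G => y i) ⁻¹' {x i} := by
    ext y
    simp [dyadicInterval]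
  rw [h]
  refine MeasurableSet.biInter (Set.to_countable _) fun i _ => ?_
  exact measurable_pi_apply i (MeasurableSet.singleton _)

theorem dyadicInterval_eq_union (n : ℕ) (x : G) :
    dyadicInterval n x = dyadicInterval (n + 1) (Function.update x n 0) ∪
      dyadicInterval (n + 1) (Function.update x n 1) := by
  ext y
  have hz : ∀ z : ZMod 2, z = 0 ∨ z = 1 := by decide
  have key : ∀ b : ZMod 2, y ∈ dyadicInterval (n + 1) (Function.update x n b) ↔
      y ∈ dyadicInterval n x ∧ y n = b := by
    intro b
    constructor
    · intro h
      refine ⟨fun i hi => ?_, ?_⟩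
      · have := h i (by omega)
        rwa [Function.update_of_ne (by omega)] at this
      · simpa using h n (by omega)
    · rintro ⟨h, hb⟩ i hi
      rcases Nat.lt_succ_iff_lt_or_eq.mp hi with h' | rfl
      · rw [Function.update_of_ne (by omega)]
        exact h i h'
      · simpa using hb
  rw [Set.mem_union, key, key]
  have := hz (y n)
  tauto

/-- The dyadic filtration: `ζ_n` is the `σ`-algebra generated by the intervals `I_n(x)`, `x ∈ G`. -/
def dyadicFiltration : Filtration ℕ (inferInstance : MeasurableSpace G) where
  seq n := MeasurableSpace.generateFrom (Set.range (dyadicInterval n))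
  mono' := by
    refine monotone_nat_of_le_succ fun n => ?_
    refine MeasurableSpace.generateFrom_le ?_
    rintro _ ⟨x, rfl⟩
    rw [dyadicInterval_eq_union]
    exact MeasurableSet.union
      (MeasurableSpace.measurableSet_generateFrom ⟨_, rfl⟩)
      (MeasurableSpace.measurableSet_generateFrom ⟨_, rfl⟩)
  le' n := by
    refine MeasurableSpace.generateFrom_le ?_
    rintro _ ⟨x, rfl⟩
    exact measurableSet_dyadicInterval n x

/-- The Rademacher functions `r_k(x) = (-1)^{x_k}`. -/
def rademacher (k : ℕ) (x : G) : ℝ := (-1) ^ (x k).val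

/-- The Walsh functions `w_n = ∏_k r_k ^ {n_k}`, where `n = ∑_k n_k 2^k` with `n_k ∈ {0, 1}`.
Only indices `k < n` matter, since `n_k = 0` whenever `n < 2^k`. -/
def walsh (n : ℕ) (x : G) : ℝ :=
  ∏ k ∈ Finset.range n, rademacher k x ^ (n.testBit k).toNat

/-- The Walsh–Fourier coefficients of a martingale `F = (F_n)`:
`F^(k) = lim_n ∫ F_n w_k dμ`; the sequence is eventually constant when `F` is a dyadic
martingale. -/
def fourierCoeff (F : ℕ → G → ℝ) (k : ℕ) : ℝ :=
  limUnder atTop (fun n => ∫ x, F n x * walsh k x ∂haar)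

/-- The partial sums `S_n F = ∑_{k < n} F^(k) w_k` of the Walsh–Fourier series. -/
def partialSum (F : ℕ → G → ℝ) (n : ℕ) (x : G) : ℝ :=
  ∑ k ∈ Finset.range n, fourierCoeff F k * walsh k x

/-- The Fejér means `σ_n F = (1/n) ∑_{k=1}^n S_k F`. -/
def fejerMean (F : ℕ → G → ℝ) (n : ℕ) (x : G) : ℝ :=
  (1 / (n : ℝ)) * ∑ k ∈ Finset.Icc 1 n, partialSum F k x

/-- The maximal function `F^* = sup_n |F_n|` (with values in `[0, ∞]`). -/
def maximalFunction (F : ℕ → G → ℝ) (x : G) : ℝ≥0∞ := ⨆ n, ENNReal.ofReal |F n x|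

/-- The quasi-norm `‖F‖_{H_p} = ‖F^*‖_p` of the martingale Hardy space. -/
def hardyNorm (p : ℝ≥0∞) (F : ℕ → G → ℝ) : ℝ≥0∞ := eLpNorm (maximalFunction F) p haar

/-- Membership in the martingale Hardy space `H_p(G)`. -/
structure MemHardy (p : ℝ≥0∞) (F : ℕ → G → ℝ) : Prop where
  martingale : Martingale F dyadicFiltration haar
  norm_lt_top : hardyNorm p F < ∞

/-- `β_k^s = 2^s + 2^{s-1} + ⋯ + 2^k`. -/
def betaNum (s k : ℕ) : ℕ := ∑ j ∈ Finset.Icc k s, 2 ^ j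

/-- The restricted weighted maximal operator
`sup_s sup_{0 ≤ k ≤ s-1} |σ_{β_k^s} F| / log² β_k^s` (with values in `[0, ∞]`). -/
def restrictedMaximal (F : ℕ → G → ℝ) (x : G) : ℝ≥0∞ :=
  ⨆ (s : ℕ) (k : ℕ) (_ : k < s),
    ENNReal.ofReal (|fejerMean F (betaNum s k) x| / Real.log (betaNum s k : ℝ) ^ 2)

end

end WalshFejer

namespace WalshFejer

/-! ### Walsh functions and kernels -/

/-! Put `m = s + 1`, so that `β_k^s = 2^m - 2^k`. As `2^k` divides this number, the unnormalized
Fejér kernel of that order is a combination of Fejér and Dirichlet kernels of orders `2^m` and `2^k`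
alone (`abs_fejerKernel_two_pow_sub_le`). All of these are dominated by translates of Dirichlet
kernels (`fejerKernel_le_majorant`). Hence `|σ F|` is controlled by weighted, translated averages of
`|F_m|` over dyadic intervals of ranks `m` and `k` (`ofReal_abs_fejerMean_le`), and the denominator
is at least `m^2 / 16`.

What remains uses no cancellation, only that `f_m = |F_m|` is adapted: the supremum over `k ≤ m` of
`m^{-2} * shiftedAvg m k f_m` must be bounded in `L_{1/2}` by `sup f_n`. Each level set `{f_m >
4^l}` is covered by disjoint cylinder sets `A_n` of ranks `n < m`, which do not depend on `m` and
have total measure at most twice that of `{sup f > 4^l}` (`tsum_haar_disjointed_le`).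

For a single `A = A_n` the square root turns `m^{-2}` into `1/m` (`sqrt_shiftedAvg_indicator_le`).
If `n ≤ k`, averaging leaves the indicator of `A` unchanged and the weights form a geometric series.
If `k < n`, an average of the indicator is zero or at least `2^{k-n}`, so its root is at most
`2^{(n-k)/2}` times the average, a loss that the weights absorb. The supremum over these `n` values
of `k` is replaced by a sum, paid for by `1/m ≤ 1/(n+1)`; this is what the squared logarithm is for.
The resulting majorant has integral at most a constant times `μ(A)`, and subadditivity of the square
root allows summation over ranks and levels. -/

theorem zmod_two_cases (a : ZMod 2) : a = 0 ∨ a = 1 := by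
  revert a; decide

theorem rademacher_add (k : ℕ) (x y : G) :
    rademacher k (x + y) = rademacher k x * rademacher k y := by
  have h : ∀ a b : ZMod 2, ((-1 : ℝ)) ^ (a + b).val = (-1) ^ a.val * (-1) ^ b.val := by
    intro a b
    rcases zmod_two_cases a with rfl | rfl <;> rcases zmod_two_cases b with rfl | rfl
    · simp
    · simp
    · simp
    · rw [show (1 : ZMod 2) + 1 = 0 by decide]
      simp [ZMod.val_one]
  exact h _ _

theorem rademacher_of_eq_zero {k : ℕ} {x : G} (h : x k = 0) : rademacher k x = 1 := by
  simp [rademacher, h]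

theorem rademacher_of_eq_one {k : ℕ} {x : G} (h : x k = 1) : rademacher k x = -1 := by
  simp [rademacher, h, ZMod.val_one]

theorem abs_rademacher (k : ℕ) (x : G) : |rademacher k x| = 1 := by
  simp [rademacher]

theorem walsh_eq_prod_range {n M : ℕ} (h : n < 2 ^ M) (x : G) :
    walsh n x = ∏ k ∈ Finset.range M, rademacher k x ^ (n.testBit k).toNat := by
  have key : ∀ A B : ℕ, n < 2 ^ A → A ≤ B →
      ∏ k ∈ Finset.range A, rademacher k x ^ (n.testBit k).toNat =
        ∏ k ∈ Finset.range B, rademacher k x ^ (n.testBit k).toNat := by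
    intro A B hA hAB
    refine Finset.prod_subset (Finset.range_mono hAB) fun k _ hk => ?_
    have hk' : A ≤ k := by simpa using hk
    rw [Nat.testBit_lt_two_pow (hA.trans_le (Nat.pow_le_pow_right two_pos hk'))]
    simp
  unfold walsh
  rcases le_total n M with h' | h'
  · exact key n M Nat.lt_two_pow_self h'
  · exact (key M n h h').symm

theorem walsh_two_pow_mul_add {a k : ℕ} (ha : a < 2 ^ k) (b : ℕ) (x : G) :
    walsh (2 ^ k * b + a) x = walsh (2 ^ k * b) x * walsh a x := by
  have h0 : 2 ^ k * b + a < 2 ^ (2 ^ k * b + a) := Nat.lt_two_pow_self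
  have h1 : 2 ^ k * b < 2 ^ (2 ^ k * b + a) := lt_of_le_of_lt (Nat.le_add_right _ _) h0
  have h2 : a < 2 ^ (2 ^ k * b + a) := lt_of_le_of_lt (Nat.le_add_left _ _) h0
  rw [walsh_eq_prod_range h0, walsh_eq_prod_range h1, walsh_eq_prod_range h2,
    ← Finset.prod_mul_distrib]
  refine Finset.prod_congr rfl fun j _ => ?_
  rw [Nat.testBit_two_pow_mul_add _ ha, Nat.testBit_two_pow_mul]
  by_cases hj : j < k
  · simp [hj, Nat.not_le.mpr hj]
  · rw [Nat.testBit_lt_two_pow (ha.trans_le (Nat.pow_le_pow_right two_pos (not_lt.mp hj)))]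
    simp [hj, not_lt.mp hj]

theorem walsh_zero (x : G) : walsh 0 x = 1 := by simp [walsh]

theorem walsh_two_pow (n : ℕ) (x : G) : walsh (2 ^ n) x = rademacher n x := by
  rw [walsh_eq_prod_range (Nat.pow_lt_pow_right one_lt_two (Nat.lt_succ_self n)),
    Finset.prod_eq_single n]
  · simp
  · intro j _ hj
    simp [Ne.symm hj]
  · simp

theorem walsh_two_pow_add {a n : ℕ} (ha : a < 2 ^ n) (x : G) :
    walsh (2 ^ n + a) x = rademacher n x * walsh a x := by
  have := walsh_two_pow_mul_add ha 1 x
  rwa [mul_one, walsh_two_pow] at this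

theorem walsh_add (n : ℕ) (x y : G) : walsh n (x + y) = walsh n x * walsh n y := by
  simp [walsh, rademacher_add, mul_pow, Finset.prod_mul_distrib]

theorem abs_walsh (n : ℕ) (x : G) : |walsh n x| = 1 := by
  simp [walsh, Finset.abs_prod, abs_pow, abs_rademacher]

/-- The element of `G` whose only non-zero coordinate is the `j`-th. -/
def unitVec (j : ℕ) : G := Pi.single j 1

theorem add_unitVec_of_ne {i j : ℕ} (h : i ≠ j) (x : G) : (x + unitVec j) i = x i := by
  simp [unitVec, h]

theorem add_unitVec_self (j : ℕ) (x : G) : (x + unitVec j) j = x j + 1 := by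
  simp [unitVec]

/-- The Dirichlet kernel `D_{2^n}`. -/
noncomputable def dirichletKernel (n : ℕ) (x : G) : ℝ := ∑ i ∈ Finset.range (2 ^ n), walsh i x

/-- The unnormalized Fejér kernel `2^n K_{2^n}`. -/
noncomputable def fejerKernel (n : ℕ) (x : G) : ℝ :=
  ∑ i ∈ Finset.range (2 ^ n), ((2 : ℝ) ^ n - i) * walsh i x

theorem dirichletKernel_succ (n : ℕ) (x : G) :
    dirichletKernel (n + 1) x = (1 + rademacher n x) * dirichletKernel n x := by
  unfold dirichletKernel
  rw [pow_succ, mul_two, Finset.sum_range_add, add_mul, one_mul, Finset.mul_sum]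
  congr 1
  exact Finset.sum_congr rfl fun i hi => walsh_two_pow_add (Finset.mem_range.mp hi) x

theorem fejerKernel_succ (n : ℕ) (x : G) :
    fejerKernel (n + 1) x =
      2 ^ n * dirichletKernel n x + (1 + rademacher n x) * fejerKernel n x := by
  unfold fejerKernel dirichletKernel
  rw [pow_succ 2 n, mul_two, Finset.sum_range_add, add_mul, one_mul, Finset.mul_sum,
    Finset.mul_sum, ← add_assoc]
  refine congrArg₂ (· + ·) ?_ ?_
  · rw [← Finset.sum_add_distrib]
    refine Finset.sum_congr rfl fun i _ => ?_
    rw [pow_succ]; ring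
  · refine Finset.sum_congr rfl fun i hi => ?_
    rw [walsh_two_pow_add (Finset.mem_range.mp hi), pow_succ]
    push_cast; ring

theorem dirichletKernel_congr {n : ℕ} {x y : G} (h : ∀ i < n, x i = y i) :
    dirichletKernel n x = dirichletKernel n y := by
  induction n with
  | zero => simp [dirichletKernel, walsh_zero]
  | succ n ih =>
    rw [dirichletKernel_succ, dirichletKernel_succ, ih fun i hi => h i (by omega)]
    simp [rademacher, h n (by omega)]

theorem dirichletKernel_eq (n : ℕ) (x : G) :
    dirichletKernel n x = if ∀ i < n, x i = 0 then 2 ^ n else 0 := by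
  induction n with
  | zero => simp [dirichletKernel, walsh_zero]
  | succ n ih =>
    rw [dirichletKernel_succ, ih]
    rcases zmod_two_cases (x n) with h | h
    · rw [rademacher_of_eq_zero h]
      have : (∀ i < n + 1, x i = 0) ↔ ∀ i < n, x i = 0 := by
        refine ⟨fun H i hi => H i (by omega), fun H i hi => ?_⟩
        rcases Nat.lt_succ_iff_lt_or_eq.mp hi with h' | rfl
        exacts [H i h', h]
      simp only [this]
      split_ifs
      · rw [pow_succ]; ring
      · ring
    · rw [rademacher_of_eq_one h]
      have : ¬ ∀ i < n + 1, x i = 0 := fun H => by simp [H n (by omega)] at h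
      rw [if_neg this]; ring

theorem dirichletKernel_nonneg (n : ℕ) (x : G) : 0 ≤ dirichletKernel n x := by
  rw [dirichletKernel_eq]; split_ifs <;> positivity

/-- A non-negative majorant of `2^n K_{2^n}` made of translates of `D_{2^n}`. -/
noncomputable def fejerMajorant (n : ℕ) (x : G) : ℝ :=
  ∑ j ∈ Finset.range (n + 1), 2 ^ j * dirichletKernel n (x + unitVec j)

theorem dirichletKernel_add_unitVec {n j : ℕ} (h : n ≤ j) (x : G) :
    dirichletKernel n (x + unitVec j) = dirichletKernel n x :=
  dirichletKernel_congr fun i hi => add_unitVec_of_ne (by omega) x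

/-- The summand `j = n` of the majorant translates in a coordinate that `D_{2^n}` does not see.
Including it lets the majorant absorb the Dirichlet terms as well. -/
theorem two_pow_mul_dirichletKernel_le (n : ℕ) (x : G) :
    2 ^ n * dirichletKernel n x ≤ fejerMajorant n x := by
  rw [← dirichletKernel_add_unitVec le_rfl x]
  exact Finset.single_le_sum
    (f := fun j => (2 : ℝ) ^ j * dirichletKernel n (x + unitVec j))
    (fun j _ => mul_nonneg (by positivity) (dirichletKernel_nonneg _ _))
    (Finset.mem_range.mpr (Nat.lt_succ_self n))

theorem fejerKernel_nonneg (n : ℕ) (x : G) : 0 ≤ fejerKernel n x := by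
  induction n with
  | zero => simp [fejerKernel, walsh_zero]
  | succ n ih =>
    rw [fejerKernel_succ]
    have h1 : 0 ≤ 1 + rademacher n x := by
      have := (abs_le.mp (abs_rademacher n x).le).1
      linarith
    have := dirichletKernel_nonneg n x
    positivity

/-- Induction through `fejerKernel_succ`. If `x_n = 0`, kernel and majorant essentially double, and
the new top summand absorbs the extra `2^n D_{2^n}`. If `x_n = 1`, only `2^n D_{2^n}` survives, and
the summand `j = n` alone dominates it. -/
theorem fejerKernel_le_majorant (n : ℕ) (x : G) : fejerKernel n x ≤ fejerMajorant n x := by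
  induction n with
  | zero => simp [fejerKernel, fejerMajorant, walsh_zero, dirichletKernel]
  | succ n ih =>
    rw [fejerKernel_succ]
    rcases zmod_two_cases (x n) with h | h
    · rw [rademacher_of_eq_zero h]
      have e1 : ∀ j ∈ Finset.range n, (2 : ℝ) ^ j * dirichletKernel (n + 1) (x + unitVec j) =
          2 * (2 ^ j * dirichletKernel n (x + unitVec j)) := by
        intro j hj
        have hj' : n ≠ j := (Finset.mem_range.mp hj).ne'
        rw [dirichletKernel_succ, rademacher_of_eq_zero ((add_unitVec_of_ne hj' x).trans h)]
        ring
      have e2 : dirichletKernel (n + 1) (x + unitVec (n + 1)) = 2 * dirichletKernel n x := by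
        rw [dirichletKernel_add_unitVec le_rfl, dirichletKernel_succ, rademacher_of_eq_zero h]
        ring
      have e3 := dirichletKernel_nonneg (n + 1) (x + unitVec n)
      have e4 := dirichletKernel_nonneg n x
      have hm : fejerMajorant n x =
          ∑ j ∈ Finset.range n, 2 ^ j * dirichletKernel n (x + unitVec j) +
            2 ^ n * dirichletKernel n x := by
        rw [fejerMajorant, Finset.sum_range_succ, dirichletKernel_add_unitVec le_rfl]
      have hm' : fejerMajorant (n + 1) x =
          2 * ∑ j ∈ Finset.range n, 2 ^ j * dirichletKernel n (x + unitVec j) +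
            2 ^ n * dirichletKernel (n + 1) (x + unitVec n) +
              2 ^ (n + 1) * (2 * dirichletKernel n x) := by
        rw [fejerMajorant, Finset.sum_range_succ, Finset.sum_range_succ,
          Finset.sum_congr rfl e1, ← Finset.mul_sum, e2]
      rw [hm] at ih
      rw [hm', pow_succ]
      have e5 : 0 ≤ (2 : ℝ) ^ n * dirichletKernel n x := by positivity
      have e6 : 0 ≤ (2 : ℝ) ^ n * dirichletKernel (n + 1) (x + unitVec n) := by positivity
      linarith
    · rw [rademacher_of_eq_one h]
      have e1 : dirichletKernel (n + 1) (x + unitVec n) = 2 * dirichletKernel n x := by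
        rw [dirichletKernel_succ, dirichletKernel_add_unitVec le_rfl, rademacher_of_eq_zero]
        · ring
        · rw [add_unitVec_self, h]; decide
      have e2 : 2 ^ n * dirichletKernel (n + 1) (x + unitVec n) ≤ fejerMajorant (n + 1) x :=
        Finset.single_le_sum
          (f := fun j => (2 : ℝ) ^ j * dirichletKernel (n + 1) (x + unitVec j))
          (fun j _ => mul_nonneg (by positivity) (dirichletKernel_nonneg _ _))
          (Finset.mem_range.mpr (by omega))
      have e3 : 0 ≤ 2 ^ n * dirichletKernel n x :=
        mul_nonneg (by positivity) (dirichletKernel_nonneg _ _)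
      rw [e1] at e2
      linarith

/-- The sum is extended to all indices below `2^m` and the tail is removed. With `N = 2^m - 2^k` a
multiple of `2^k`, the tail factors as `w_N` times a sum over `i < 2^k` with coefficients `-i = (2^k
- i) - 2^k`, again a Fejér minus a Dirichlet kernel. -/
theorem abs_fejerKernel_two_pow_sub_le {k m : ℕ} (hkm : k ≤ m) (x : G) :
    |∑ i ∈ Finset.range (2 ^ m - 2 ^ k), ((2 : ℝ) ^ m - 2 ^ k - i) * walsh i x| ≤
      fejerMajorant m x + fejerMajorant k x := by
  have hle : 2 ^ k ≤ 2 ^ m := Nat.pow_le_pow_right two_pos hkm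
  obtain ⟨b, hb⟩ : ∃ b, 2 ^ m - 2 ^ k = 2 ^ k * b := by
    refine ⟨2 ^ (m - k) - 1, ?_⟩
    rw [Nat.mul_sub, ← pow_add, mul_one]
    congr 2; omega
  set N := 2 ^ m - 2 ^ k with hN
  have hNm : 2 ^ m = N + 2 ^ k := by omega
  have hNr : (2 : ℝ) ^ m = N + 2 ^ k := by exact_mod_cast hNm
  have h1 : fejerKernel m x - 2 ^ k * dirichletKernel m x =
      ∑ i ∈ Finset.range (2 ^ m), ((2 : ℝ) ^ m - 2 ^ k - i) * walsh i x := by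
    rw [fejerKernel, dirichletKernel, Finset.mul_sum, ← Finset.sum_sub_distrib]
    exact Finset.sum_congr rfl fun i _ => by ring
  have h2 : ∑ i ∈ Finset.range (2 ^ k), ((2 : ℝ) ^ m - 2 ^ k - ↑(N + i)) * walsh (N + i) x =
      walsh N x * (fejerKernel k x - 2 ^ k * dirichletKernel k x) := by
    rw [fejerKernel, dirichletKernel, Finset.mul_sum, ← Finset.sum_sub_distrib, Finset.mul_sum]
    refine Finset.sum_congr rfl fun i hi => ?_
    rw [hb, walsh_two_pow_mul_add (Finset.mem_range.mp hi), ← hb, hNr]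
    push_cast; ring
  have h3 : ∑ i ∈ Finset.range N, ((2 : ℝ) ^ m - 2 ^ k - i) * walsh i x =
      (fejerKernel m x - 2 ^ k * dirichletKernel m x) -
        walsh N x * (fejerKernel k x - 2 ^ k * dirichletKernel k x) := by
    rw [h1, ← h2, hNm, Finset.sum_range_add, add_sub_cancel_right]
  have hD : 2 ^ k * dirichletKernel m x ≤ 2 ^ m * dirichletKernel m x :=
    mul_le_mul_of_nonneg_right (by exact_mod_cast hle) (dirichletKernel_nonneg _ _)
  -- Both terms lie between zero and the majorant, hence so does the absolute value of their
  -- difference.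
  have a1 : |fejerKernel m x - 2 ^ k * dirichletKernel m x| ≤ fejerMajorant m x := by
    have := fejerKernel_le_majorant m x
    have := fejerKernel_nonneg m x
    have := two_pow_mul_dirichletKernel_le m x
    have : 0 ≤ 2 ^ k * dirichletKernel m x :=
      mul_nonneg (by positivity) (dirichletKernel_nonneg _ _)
    rw [abs_le]; constructor <;> linarith
  have a2 : |fejerKernel k x - 2 ^ k * dirichletKernel k x| ≤ fejerMajorant k x := by
    have := fejerKernel_le_majorant k x
    have := fejerKernel_nonneg k x
    have := two_pow_mul_dirichletKernel_le k x
    have : 0 ≤ 2 ^ k * dirichletKernel k x :=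
      mul_nonneg (by positivity) (dirichletKernel_nonneg _ _)
    rw [abs_le]; constructor <;> linarith
  rw [h3]
  refine (abs_sub _ _).trans (add_le_add a1 ?_)
  rwa [abs_mul, abs_walsh, one_mul]

theorem betaNum_eq {s k : ℕ} (h : k < s) : betaNum s k = 2 ^ (s + 1) - 2 ^ k := by
  unfold betaNum
  induction s with
  | zero => omega
  | succ s ih =>
    rw [Finset.sum_Icc_succ_top (by omega)]
    have h2 : 2 ^ k ≤ 2 ^ (s + 1) := Nat.pow_le_pow_right two_pos (by omega)
    rcases Nat.lt_succ_iff_lt_or_eq.mp h with h' | rfl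
    · rw [ih h', pow_succ 2 (s + 1)]
      omega
    · simp only [Finset.Icc_self, Finset.sum_singleton, pow_succ]
      omega

/-! ### Haar measure and averages over dyadic intervals -/

theorem mem_dyadicInterval_comm {n : ℕ} {x y : G} :
    y ∈ dyadicInterval n x ↔ x ∈ dyadicInterval n y :=
  ⟨fun h i hi => (h i hi).symm, fun h i hi => (h i hi).symm⟩

theorem dyadicInterval_eq_of_mem {n : ℕ} {x y : G} (h : y ∈ dyadicInterval n x) :
    dyadicInterval n y = dyadicInterval n x := by
  ext z
  exact ⟨fun hz i hi => (hz i hi).trans (h i hi), fun hz i hi => (hz i hi).trans (h i hi).symm⟩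

theorem dyadicInterval_anti {m n : ℕ} (h : m ≤ n) (x : G) :
    dyadicInterval n x ⊆ dyadicInterval m x :=
  fun _ hy i hi => hy i (hi.trans_le h)

theorem add_unitVec_mem_dyadicInterval {n j : ℕ} (h : n ≤ j) (x : G) :
    x + unitVec j ∈ dyadicInterval n x :=
  fun i hi => add_unitVec_of_ne (by omega) x

theorem muZ2_singleton (a : ZMod 2) : muZ2 {a} = 2⁻¹ := by
  rcases zmod_two_cases a with rfl | rfl <;> simp [muZ2]

theorem haar_dyadicInterval (n : ℕ) (x : G) : haar (dyadicInterval n x) = 2⁻¹ ^ n := by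
  have h : dyadicInterval n x = ((Finset.range n : Finset ℕ) : Set ℕ).pi fun i => {x i} := by
    ext y
    simp [dyadicInterval, Set.mem_pi]
  rw [h, haar, Measure.infinitePi_pi _ fun i _ => MeasurableSet.singleton _]
  simp [muZ2_singleton]

theorem measurable_add_unitVec (j : ℕ) : Measurable fun x : G => x + unitVec j := by
  refine measurable_pi_lambda _ fun i => ?_
  exact (measurable_of_countable fun a : ZMod 2 => a + unitVec j i).comp (measurable_pi_apply i)

theorem map_add_muZ2 (a : ZMod 2) : Measure.map (fun b => b + a) muZ2 = muZ2 := by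
  rcases zmod_two_cases a with rfl | rfl
  · simp
  · have hm : Measurable fun b : ZMod 2 => b + 1 := measurable_of_countable _
    rw [muZ2, Measure.map_smul, Measure.map_add _ _ hm, Measure.map_dirac' hm,
      Measure.map_dirac' hm, zero_add, show (1 : ZMod 2) + 1 = 0 by decide, add_comm]

theorem measurePreserving_add_unitVec (j : ℕ) :
    MeasurePreserving (fun x : G => x + unitVec j) haar haar := by
  refine ⟨measurable_add_unitVec j, ?_⟩
  have := Measure.infinitePi_map_pi (fun _ : ℕ => muZ2)
    (f := fun i b => b + unitVec j i) fun i => measurable_of_countable _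
  simp only [map_add_muZ2] at this
  exact this

/-- The conditional expectation of a non-negative function on the dyadic intervals of rank `k`. -/
noncomputable def cylAvg (k : ℕ) (g : G → ℝ≥0∞) (x : G) : ℝ≥0∞ :=
  2 ^ k * ∫⁻ y in dyadicInterval k x, g y ∂haar

theorem two_pow_mul_inv_two_pow (k : ℕ) : (2 : ℝ≥0∞) ^ k * 2⁻¹ ^ k = 1 := by
  rw [← mul_pow, ENNReal.mul_inv_cancel two_ne_zero ENNReal.ofNat_ne_top, one_pow]

theorem cylAvg_mono (k : ℕ) {f g : G → ℝ≥0∞} (h : ∀ x, f x ≤ g x) (x : G) :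
    cylAvg k f x ≤ cylAvg k g x := by
  unfold cylAvg
  gcongr
  exact h _

theorem cylAvg_tsum {ι : Type*} [Countable ι] (k : ℕ) {g : ι → G → ℝ≥0∞}
    (hg : ∀ i, Measurable (g i)) (x : G) :
    cylAvg k (fun y => ∑' i, g i y) x = ∑' i, cylAvg k (g i) x := by
  unfold cylAvg
  rw [lintegral_tsum fun i => (hg i).aemeasurable, ENNReal.tsum_mul_left]

theorem cylAvg_const_mul (k : ℕ) (c : ℝ≥0∞) {g : G → ℝ≥0∞} (hg : Measurable g) (x : G) :
    cylAvg k (fun y => c * g y) x = c * cylAvg k g x := by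
  unfold cylAvg
  rw [lintegral_const_mul _ hg, mul_left_comm]

theorem measurableSet_dyadicRel (k : ℕ) :
    MeasurableSet {p : G × G | p.2 ∈ dyadicInterval k p.1} := by
  have h : {p : G × G | p.2 ∈ dyadicInterval k p.1} =
      ⋂ i ∈ Set.Iio k, {p : G × G | p.2 i = p.1 i} := by
    ext p
    simp [dyadicInterval]
  rw [h]
  refine MeasurableSet.biInter (Set.to_countable _) fun i _ => ?_
  exact measurableSet_eq_fun ((measurable_pi_apply i).comp measurable_snd)
    ((measurable_pi_apply i).comp measurable_fst)

theorem measurable_indicator_dyadicRel (k : ℕ) {g : G → ℝ≥0∞} (hg : Measurable g) :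
    Measurable (Function.uncurry fun x y => (dyadicInterval k x).indicator g y) := by
  have : (Function.uncurry fun x y => (dyadicInterval k x).indicator g y) =
      {p : G × G | p.2 ∈ dyadicInterval k p.1}.indicator fun p => g p.2 := by
    ext p
    simp [Function.uncurry, Set.indicator]
  rw [this]
  exact (hg.comp measurable_snd).indicator (measurableSet_dyadicRel k)

theorem cylAvg_eq_lintegral_indicator (k : ℕ) (g : G → ℝ≥0∞) (x : G) :
    cylAvg k g x = 2 ^ k * ∫⁻ y, (dyadicInterval k x).indicator g y ∂haar := by
  rw [cylAvg, lintegral_indicator (measurableSet_dyadicInterval k x)]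

theorem measurable_cylAvg (k : ℕ) {g : G → ℝ≥0∞} (hg : Measurable g) :
    Measurable (cylAvg k g) := by
  have : cylAvg k g = fun x => 2 ^ k * ∫⁻ y, (dyadicInterval k x).indicator g y ∂haar :=
    funext fun x => cylAvg_eq_lintegral_indicator k g x
  rw [this]
  exact (Measurable.lintegral_prod_right' (measurable_indicator_dyadicRel k hg)).const_mul _

/-- Fubini, using that `y ∈ I_k(x)` is a symmetric relation. -/
theorem lintegral_cylAvg (k : ℕ) {g : G → ℝ≥0∞} (hg : Measurable g) :
    ∫⁻ x, cylAvg k g x ∂haar = ∫⁻ x, g x ∂haar := by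
  have hm := measurable_indicator_dyadicRel k hg
  have hm' : Measurable fun x => ∫⁻ y, (dyadicInterval k x).indicator g y ∂haar :=
    Measurable.lintegral_prod_right' hm
  simp_rw [cylAvg_eq_lintegral_indicator]
  rw [lintegral_const_mul _ hm', lintegral_lintegral_swap hm.aemeasurable]
  have h : ∀ y, ∫⁻ x, (dyadicInterval k x).indicator g y ∂haar = 2⁻¹ ^ k * g y := by
    intro y
    have : (fun x => (dyadicInterval k x).indicator g y) =
        (dyadicInterval k y).indicator fun _ => g y := by
      ext x
      by_cases h : y ∈ dyadicInterval k x
      · simp [h, mem_dyadicInterval_comm.mp h]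
      · simp [h, mt mem_dyadicInterval_comm.mp h]
    rw [this, lintegral_indicator (measurableSet_dyadicInterval k y), setLIntegral_const,
      haar_dyadicInterval, mul_comm]
  simp_rw [h]
  rw [lintegral_const_mul _ hg, ← mul_assoc, two_pow_mul_inv_two_pow, one_mul]

theorem lintegral_comp_add_unitVec (j : ℕ) {g : G → ℝ≥0∞} (hg : Measurable g) :
    ∫⁻ x, g (x + unitVec j) ∂haar = ∫⁻ x, g x ∂haar :=
  (measurePreserving_add_unitVec j).lintegral_comp hg

/-- `A` is a union of dyadic intervals of rank `n`. -/
def IsCylinderSet (n : ℕ) (A : Set G) : Prop :=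
  ∀ x y, y ∈ dyadicInterval n x → (y ∈ A ↔ x ∈ A)

theorem IsCylinderSet.mono {m n : ℕ} (h : m ≤ n) {A : Set G} (hA : IsCylinderSet m A) :
    IsCylinderSet n A :=
  fun x y hy => hA x y (dyadicInterval_anti h x hy)

theorem IsCylinderSet.disjointed {B : ℕ → Set G} (hB : ∀ n, IsCylinderSet n (B n)) (n : ℕ) :
    IsCylinderSet n (disjointed B n) := by
  intro x y hy
  simp only [disjointed_eq_inter_compl, Set.mem_inter_iff, Set.mem_iInter, Set.mem_compl_iff]
  rw [hB n x y hy]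
  refine and_congr_right fun _ => forall₂_congr fun i hi => ?_
  rw [(hB i).mono hi.le x y hy]

theorem cylAvg_indicator_of_le {n k : ℕ} (h : n ≤ k) {A : Set G} (hA : IsCylinderSet n A)
    (x : G) : cylAvg k (A.indicator 1) x = A.indicator 1 x := by
  have e : ∫⁻ y in dyadicInterval k x, A.indicator (1 : G → ℝ≥0∞) y ∂haar =
      ∫⁻ _ in dyadicInterval k x, A.indicator (1 : G → ℝ≥0∞) x ∂haar := by
    refine setLIntegral_congr_fun (measurableSet_dyadicInterval k x) fun y hy => ?_
    by_cases hx : x ∈ A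
    · simp [hx, (hA.mono h x y hy).mpr hx]
    · simp [hx, mt (hA.mono h x y hy).mp hx]
  rw [cylAvg, e, setLIntegral_const, haar_dyadicInterval, mul_left_comm,
    two_pow_mul_inv_two_pow, mul_one]

theorem one_le_two_pow_mul_cylAvg {n k : ℕ} (h : k ≤ n) {A : Set G} (hA : IsCylinderSet n A)
    (hAm : MeasurableSet A) {x y : G} (hy : y ∈ dyadicInterval k x) (hyA : y ∈ A) :
    1 ≤ 2 ^ (n - k) * cylAvg k (A.indicator 1) x := by
  have hsub : dyadicInterval n y ⊆ A ∩ dyadicInterval k x := fun z hz =>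
    ⟨(hA y z hz).mpr hyA, dyadicInterval_eq_of_mem hy ▸ dyadicInterval_anti h y hz⟩
  have h1 : (2⁻¹ : ℝ≥0∞) ^ n ≤ ∫⁻ z in dyadicInterval k x, A.indicator 1 z ∂haar := by
    rw [lintegral_indicator_one hAm, Measure.restrict_apply hAm, ← haar_dyadicInterval n y]
    exact measure_mono hsub
  calc (1 : ℝ≥0∞) = 2 ^ (n - k) * (2 ^ k * 2⁻¹ ^ n) := by
        rw [← mul_assoc, ← pow_add, Nat.sub_add_cancel h, two_pow_mul_inv_two_pow]
    _ ≤ _ := by unfold cylAvg; gcongr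

/-- A union of rank `n` intervals that meets `I_k(x)` fills at least the fraction `2^{k-n}` of it.
Thus the average `t` is zero or satisfies `1 ≤ 2^{n-k} t`, and multiplying `√t` by the root of the
right side gives the bound. -/
theorem sqrt_cylAvg_le {n k : ℕ} (h : k ≤ n) {A : Set G} (hA : IsCylinderSet n A)
    (hAm : MeasurableSet A) (x : G) :
    cylAvg k (A.indicator 1) x ^ (1 / 2 : ℝ) ≤
      ((2 : ℝ≥0∞) ^ (1 / 2 : ℝ)) ^ (n - k) * cylAvg k (A.indicator 1) x := by
  by_cases hne : ∃ y ∈ dyadicInterval k x, y ∈ A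
  · obtain ⟨y, hy, hyA⟩ := hne
    have h1 := one_le_two_pow_mul_cylAvg h hA hAm hy hyA
    set t := cylAvg k (A.indicator 1) x
    have h2 : (1 : ℝ≥0∞) ≤ (2 ^ (n - k) * t) ^ (1 / 2 : ℝ) := ENNReal.one_le_rpow h1 (by norm_num)
    calc t ^ (1 / 2 : ℝ) = t ^ (1 / 2 : ℝ) * 1 := (mul_one _).symm
      _ ≤ t ^ (1 / 2 : ℝ) * (2 ^ (n - k) * t) ^ (1 / 2 : ℝ) := by gcongr
      _ = ((2 : ℝ≥0∞) ^ (1 / 2 : ℝ)) ^ (n - k) * (t ^ (1 / 2 : ℝ) * t ^ (1 / 2 : ℝ)) := by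
          rw [ENNReal.mul_rpow_of_nonneg _ _ (by norm_num), ← ENNReal.rpow_natCast,
            ← ENNReal.rpow_natCast, ← ENNReal.rpow_mul, ← ENNReal.rpow_mul,
            mul_comm (1 / 2 : ℝ)]
          ring
      _ = _ := by
          rw [← ENNReal.rpow_add_of_nonneg _ _ (by norm_num) (by norm_num)]
          norm_num
  · have h0 : cylAvg k (A.indicator 1) x = 0 := by
      have e : ∫⁻ y in dyadicInterval k x, A.indicator (1 : G → ℝ≥0∞) y ∂haar =
          ∫⁻ _ in dyadicInterval k x, 0 ∂haar := by
        refine setLIntegral_congr_fun (measurableSet_dyadicInterval k x) fun y hy => ?_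
        exact Set.indicator_of_notMem (fun hyA => hne ⟨y, hy, hyA⟩) _
      rw [cylAvg, e, lintegral_zero, mul_zero]
    rw [h0]
    simp

/-! ### Square roots of sums in `ℝ≥0∞` -/

theorem sqrt_sum_le {ι : Type*} (s : Finset ι) (f : ι → ℝ≥0∞) :
    (∑ i ∈ s, f i) ^ (1 / 2 : ℝ) ≤ ∑ i ∈ s, f i ^ (1 / 2 : ℝ) := by
  classical
  induction s using Finset.induction_on with
  | empty => simp
  | insert a s ha ih =>
    rw [Finset.sum_insert ha, Finset.sum_insert ha]
    exact (ENNReal.rpow_add_le_add_rpow _ _ (by norm_num) (by norm_num)).trans (by gcongr)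

theorem sqrt_tsum_le {ι : Type*} (f : ι → ℝ≥0∞) :
    (∑' i, f i) ^ (1 / 2 : ℝ) ≤ ∑' i, f i ^ (1 / 2 : ℝ) := by
  have hs : Tendsto (fun s : Finset ι => (∑ i ∈ s, f i) ^ (1 / 2 : ℝ)) atTop
      (nhds ((∑' i, f i) ^ (1 / 2 : ℝ))) :=
    (ENNReal.continuous_rpow_const.tendsto _).comp ENNReal.summable.hasSum
  exact le_of_tendsto' hs fun s => (sqrt_sum_le s f).trans (ENNReal.sum_le_tsum s)

theorem sqrt_sq (t : ℝ≥0∞) : (t ^ 2) ^ (1 / 2 : ℝ) = t := by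
  rw [← ENNReal.rpow_natCast, ← ENNReal.rpow_mul]
  norm_num

/-- The square root of `1/2`. -/
noncomputable def sqrtHalf : ℝ≥0∞ := 2⁻¹ ^ (1 / 2 : ℝ)

theorem sqrtHalf_lt_one : sqrtHalf < 1 :=
  ENNReal.rpow_lt_one (by simp) (by norm_num)

theorem sqrtHalf_mul_sqrt_two : sqrtHalf * 2 ^ (1 / 2 : ℝ) = 1 := by
  rw [sqrtHalf, ← ENNReal.mul_rpow_of_nonneg _ _ (by norm_num),
    ENNReal.inv_mul_cancel two_ne_zero ENNReal.ofNat_ne_top, ENNReal.one_rpow]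

theorem sqrt_inv_two_pow (n : ℕ) : ((2⁻¹ : ℝ≥0∞) ^ n) ^ (1 / 2 : ℝ) = sqrtHalf ^ n := by
  rw [sqrtHalf, ← ENNReal.rpow_natCast, ← ENNReal.rpow_natCast, ← ENNReal.rpow_mul,
    ← ENNReal.rpow_mul, mul_comm]

/-- The sum of the geometric series with ratio `sqrtHalf`. -/
noncomputable def sqrtHalfSum : ℝ≥0∞ := ∑' n : ℕ, sqrtHalf ^ n

theorem sqrtHalfSum_ne_top : sqrtHalfSum ≠ ∞ := by
  rw [sqrtHalfSum, ENNReal.tsum_geometric]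
  exact ENNReal.inv_ne_top.mpr (tsub_pos_iff_lt.mpr sqrtHalf_lt_one).ne'

theorem sum_sqrtHalf_pow_sub_le (M : ℕ) {s : Finset ℕ} (hs : s ⊆ Finset.range (M + 1)) :
    ∑ j ∈ s, sqrtHalf ^ (M - j) ≤ sqrtHalfSum := by
  refine (Finset.sum_le_sum_of_subset hs).trans ?_
  have := Finset.sum_range_reflect (fun j => sqrtHalf ^ j) (M + 1)
  simp only [add_tsub_cancel_right] at this
  rw [this]
  exact ENNReal.sum_le_tsum _

/-- If `2^J < u ≤ 2^{J+1}`, only the terms `j ≤ J` survive, and they sum to `2^{J+2} = 4 * 2^J`. -/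
theorem tsum_two_zpow_indicator_le (u : ℝ≥0∞) :
    ∑' j : ℤ, (2 : ℝ≥0∞) ^ (j + 1) * {v : ℝ≥0∞ | (2 : ℝ≥0∞) ^ j < v}.indicator 1 u ≤ 4 * u := by
  rcases eq_or_ne u ∞ with rfl | hu
  · rw [ENNReal.mul_top (by norm_num)]; exact le_top
  rcases eq_or_ne u 0 with rfl | hu0
  · simp
  obtain ⟨J, hJ1, hJ2⟩ := ENNReal.exists_mem_Ioc_zpow (y := 2) hu0 hu ENNReal.one_lt_two
    ENNReal.ofNat_ne_top
  set f : ℤ → ℝ≥0∞ := fun j =>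
    (2 : ℝ≥0∞) ^ (j + 1) * {v : ℝ≥0∞ | (2 : ℝ≥0∞) ^ j < v}.indicator 1 u with hf
  have hinj : Function.Injective fun d : ℕ => J - (d : ℤ) := fun a b h => by
    simpa using h
  have hsupp : Function.support f ⊆ Set.range fun d : ℕ => J - (d : ℤ) := by
    intro j hj
    have hj' : (2 : ℝ≥0∞) ^ j < u := by
      by_contra hcon
      exact hj (by simp [hf, Set.indicator, hcon])
    have : j ≤ J := by
      by_contra hcon
      have : (2 : ℝ≥0∞) ^ (J + 1) ≤ 2 ^ j :=
        ENNReal.zpow_le_of_le one_le_two (by omega)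
      exact absurd (hj'.trans_le hJ2) (not_lt.mpr this)
    exact ⟨(J - j).toNat, by simp only; omega⟩
  rw [← hinj.tsum_eq hsupp]
  have hle : ∀ d : ℕ, f (J - d) ≤ 2 ^ (J + 1) * 2⁻¹ ^ d := by
    intro d
    have h1 : f (J - d) ≤ 2 ^ (J - d + 1) := by
      refine mul_le_of_le_one_right' ?_
      exact Set.indicator_le_self' (fun _ _ => zero_le) _
    refine h1.trans_eq ?_
    rw [show J - d + 1 = (J + 1) + (-(d : ℤ)) by ring,
      ENNReal.zpow_add two_ne_zero ENNReal.ofNat_ne_top, ENNReal.zpow_neg, zpow_natCast,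
      ENNReal.inv_pow]
  calc ∑' d : ℕ, f (J - d) ≤ ∑' d : ℕ, 2 ^ (J + 1) * 2⁻¹ ^ d := ENNReal.tsum_le_tsum hle
    _ = 2 ^ (J + 1) * 2 := by
        rw [ENNReal.tsum_mul_left, ENNReal.tsum_geometric, ENNReal.one_sub_inv_two, inv_inv]
    _ = 2 ^ J * 4 := by
        rw [ENNReal.zpow_add two_ne_zero ENNReal.ofNat_ne_top, zpow_one, mul_assoc]
        norm_num
    _ ≤ 4 * u := by rw [mul_comm]; gcongr

/-! ### The weighted maximal inequality for adapted sequences -/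

/-- A weighted sum of translated averages over dyadic intervals of rank `k`, majorizing the
convolution with `K_{2^k}` up to the factor `2^{k - m}`. -/
noncomputable def shiftedAvg (m k : ℕ) (g : G → ℝ≥0∞) (x : G) : ℝ≥0∞ :=
  ∑ j ∈ Finset.range (k + 1), 2⁻¹ ^ (m - j) * cylAvg k g (x + unitVec j)

theorem shiftedAvg_mono (m k : ℕ) {f g : G → ℝ≥0∞} (h : ∀ x, f x ≤ g x) (x : G) :
    shiftedAvg m k f x ≤ shiftedAvg m k g x := by
  unfold shiftedAvg
  gcongr
  exact cylAvg_mono k h _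

theorem shiftedAvg_tsum {ι : Type*} [Countable ι] (m k : ℕ) {g : ι → G → ℝ≥0∞}
    (hg : ∀ i, Measurable (g i)) (x : G) :
    shiftedAvg m k (fun y => ∑' i, g i y) x = ∑' i, shiftedAvg m k (g i) x := by
  simp only [shiftedAvg, cylAvg_tsum k hg, ← ENNReal.tsum_mul_left]
  exact (Summable.tsum_finsetSum fun _ _ => ENNReal.summable).symm

theorem shiftedAvg_const_mul (m k : ℕ) (c : ℝ≥0∞) {g : G → ℝ≥0∞} (hg : Measurable g) (x : G) :
    shiftedAvg m k (fun y => c * g y) x = c * shiftedAvg m k g x := by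
  simp only [shiftedAvg, cylAvg_const_mul k c hg, Finset.mul_sum]
  exact Finset.sum_congr rfl fun _ _ => mul_left_comm _ _ _

/-- A majorant, independent of `m` and `k`, of the square root of the weighted `shiftedAvg m k`
of the indicator of a union of dyadic intervals of rank `n < m`. -/
noncomputable def cylMajorant (n : ℕ) (A : Set G) (x : G) : ℝ≥0∞ :=
  sqrtHalfSum * A.indicator 1 x +
    ∑ j ∈ Finset.range n, sqrtHalf ^ (n - j) * A.indicator 1 (x + unitVec j) +
    (↑(n + 1))⁻¹ * ∑ k ∈ Finset.range n, ∑ j ∈ Finset.range (k + 1),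
      sqrtHalf ^ (k - j) * cylAvg k (A.indicator 1) (x + unitVec j)

theorem sqrtHalf_pow_anti {a b : ℕ} (h : a ≤ b) : sqrtHalf ^ b ≤ sqrtHalf ^ a :=
  pow_le_pow_right_of_le_one' sqrtHalf_lt_one.le h

theorem measurable_indicator_one {A : Set G} (hA : MeasurableSet A) :
    Measurable (A.indicator (1 : G → ℝ≥0∞)) :=
  measurable_one.indicator hA

theorem sqrt_shiftedAvg_indicator_le {n m k : ℕ} (hnm : n < m) (hkm : k ≤ m) {A : Set G}
    (hA : IsCylinderSet n A) (hAm : MeasurableSet A) (x : G) :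
    (((m : ℝ≥0∞) ^ 2)⁻¹ * shiftedAvg m k (A.indicator 1) x) ^ (1 / 2 : ℝ) ≤
      cylMajorant n A x := by
  have h1 : (((m : ℝ≥0∞) ^ 2)⁻¹ * shiftedAvg m k (A.indicator 1) x) ^ (1 / 2 : ℝ) ≤
      (m : ℝ≥0∞)⁻¹ * ∑ j ∈ Finset.range (k + 1), sqrtHalf ^ (m - j) *
        cylAvg k (A.indicator 1) (x + unitVec j) ^ (1 / 2 : ℝ) := by
    rw [ENNReal.mul_rpow_of_nonneg _ _ (by norm_num), ENNReal.inv_rpow, sqrt_sq]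
    gcongr
    refine (sqrt_sum_le _ _).trans (Finset.sum_le_sum fun j _ => ?_)
    rw [ENNReal.mul_rpow_of_nonneg _ _ (by norm_num), sqrt_inv_two_pow]
  refine h1.trans ?_
  -- For `n ≤ k` the factor `1/m` is discarded and the first two terms of `cylMajorant` suffice; for
  -- `k < n` it is needed, and the third term is used.
  rcases le_or_gt n k with hnk | hkn
  · have hm1 : (m : ℝ≥0∞)⁻¹ ≤ 1 := by
      rw [ENNReal.inv_le_one]; exact_mod_cast (by omega : 1 ≤ m)
    have hsq : ∀ y : G, (A.indicator (1 : G → ℝ≥0∞) y) ^ (1 / 2 : ℝ) = A.indicator 1 y := by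
      intro y
      by_cases hy : y ∈ A <;> simp [hy]
    have h2 : ∑ j ∈ Finset.range (k + 1), sqrtHalf ^ (m - j) *
        cylAvg k (A.indicator 1) (x + unitVec j) ^ (1 / 2 : ℝ) ≤
        sqrtHalfSum * A.indicator 1 x +
          ∑ j ∈ Finset.range n, sqrtHalf ^ (n - j) * A.indicator 1 (x + unitVec j) := by
      simp only [cylAvg_indicator_of_le hnk hA, hsq]
      rw [← Finset.sum_range_add_sum_Ico _ (by omega : n ≤ k + 1), add_comm]
      refine add_le_add ?_ ?_
      -- Translations in coordinates `j ≥ n` preserve a cylinder set of rank `n`.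
      · have : ∀ j ∈ Finset.Ico n (k + 1),
            sqrtHalf ^ (m - j) * A.indicator (1 : G → ℝ≥0∞) (x + unitVec j) =
              sqrtHalf ^ (m - j) * A.indicator 1 x := by
          intro j hj
          have := hA x _ (add_unitVec_mem_dyadicInterval (Finset.mem_Ico.mp hj).1 x)
          congr 1
          by_cases hx : x ∈ A
          · simp [hx, this.mpr hx]
          · simp [hx, mt this.mp hx]
        rw [Finset.sum_congr rfl this, ← Finset.sum_mul]
        gcongr
        refine sum_sqrtHalf_pow_sub_le m fun j hj => ?_
        have := Finset.mem_Ico.mp hj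
        exact Finset.mem_range.mpr (by omega)
      · refine Finset.sum_le_sum fun j _ => ?_
        gcongr ?_ * _
        exact sqrtHalf_pow_anti (by omega)
    calc _ ≤ 1 * (sqrtHalfSum * A.indicator 1 x +
          ∑ j ∈ Finset.range n, sqrtHalf ^ (n - j) * A.indicator 1 (x + unitVec j)) := by
          gcongr
      _ ≤ _ := by
          rw [one_mul]
          exact le_self_add
  · have hm1 : (m : ℝ≥0∞)⁻¹ ≤ (↑(n + 1))⁻¹ := by
      rw [ENNReal.inv_le_inv]; exact_mod_cast hnm
    have h2 : ∀ j ∈ Finset.range (k + 1), sqrtHalf ^ (m - j) *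
        cylAvg k (A.indicator 1) (x + unitVec j) ^ (1 / 2 : ℝ) ≤
          sqrtHalf ^ (k - j) * cylAvg k (A.indicator 1) (x + unitVec j) := by
      intro j hj
      have hj' := Finset.mem_range.mp hj
      -- From `n < m` the weight contains `n - k` spare factors `√(1/2)`, exactly cancelling the
      -- `√2` powers lost in `sqrt_cylAvg_le`.
      calc _ ≤ sqrtHalf ^ ((k - j) + (n - k)) *
            (((2 : ℝ≥0∞) ^ (1 / 2 : ℝ)) ^ (n - k) *
              cylAvg k (A.indicator 1) (x + unitVec j)) := by
            gcongr ?_ * ?_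
            · exact sqrtHalf_pow_anti (by omega)
            · exact sqrt_cylAvg_le hkn.le hA hAm _
        _ = sqrtHalf ^ (k - j) * (sqrtHalf * 2 ^ (1 / 2 : ℝ)) ^ (n - k) *
              cylAvg k (A.indicator 1) (x + unitVec j) := by
            rw [pow_add, mul_pow]; ring
        _ = _ := by rw [sqrtHalf_mul_sqrt_two, one_pow, mul_one]
    refine le_trans ?_ le_add_self
    gcongr
    refine (Finset.sum_le_sum h2).trans ?_
    -- Summing over every `k < n` makes the bound independent of `k`.
    exact Finset.single_le_sum (f := fun k => ∑ j ∈ Finset.range (k + 1),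
      sqrtHalf ^ (k - j) * cylAvg k (A.indicator 1) (x + unitVec j))
      (fun _ _ => zero_le) (Finset.mem_range.mpr hkn)

theorem measurable_cylMajorant (n : ℕ) {A : Set G} (hA : MeasurableSet A) :
    Measurable (cylMajorant n A) := by
  have hi := measurable_indicator_one hA
  refine ((hi.const_mul _).add ?_).add (Measurable.const_mul ?_ _)
  · exact Finset.measurable_fun_sum _ fun j _ =>
      (hi.comp (measurable_add_unitVec j)).const_mul _
  · exact Finset.measurable_fun_sum _ fun k _ => Finset.measurable_fun_sum _ fun j _ =>
      ((measurable_cylAvg k hi).comp (measurable_add_unitVec j)).const_mul _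

/-- Translations and dyadic averages preserve integrals, so each of the three terms costs at most
`sqrtHalfSum * haar A`; in the third, `n` such costs are divided by `n + 1`. -/
theorem lintegral_cylMajorant_le (n : ℕ) {A : Set G} (hA : MeasurableSet A) :
    ∫⁻ x, cylMajorant n A x ∂haar ≤ 3 * sqrtHalfSum * haar A := by
  have hi := measurable_indicator_one hA
  have hi' : ∀ j, Measurable fun x => A.indicator (1 : G → ℝ≥0∞) (x + unitVec j) :=
    fun j => hi.comp (measurable_add_unitVec j)
  have hc : ∀ k j, Measurable fun x => cylAvg k (A.indicator 1) (x + unitVec j) :=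
    fun k j => (measurable_cylAvg k hi).comp (measurable_add_unitVec j)
  have e1 : ∀ j, ∫⁻ x, A.indicator (1 : G → ℝ≥0∞) (x + unitVec j) ∂haar = haar A := fun j => by
    rw [lintegral_comp_add_unitVec j hi, lintegral_indicator_one hA]
  have e2 : ∀ k j, ∫⁻ x, cylAvg k (A.indicator 1) (x + unitVec j) ∂haar = haar A :=
    fun k j => by
      rw [lintegral_comp_add_unitVec j (measurable_cylAvg k hi), lintegral_cylAvg k hi,
        lintegral_indicator_one hA]
  have m1 : Measurable fun x => sqrtHalfSum * A.indicator (1 : G → ℝ≥0∞) x := hi.const_mul _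
  have m2 : Measurable fun x =>
      ∑ j ∈ Finset.range n, sqrtHalf ^ (n - j) * A.indicator (1 : G → ℝ≥0∞) (x + unitVec j) :=
    Finset.measurable_fun_sum _ fun j _ => (hi' j).const_mul _
  have m3 : ∀ k, Measurable fun x => ∑ j ∈ Finset.range (k + 1),
      sqrtHalf ^ (k - j) * cylAvg k (A.indicator 1) (x + unitVec j) :=
    fun k => Finset.measurable_fun_sum _ fun j _ => (hc k j).const_mul _
  have m12 : Measurable fun x => sqrtHalfSum * A.indicator (1 : G → ℝ≥0∞) x +
      ∑ j ∈ Finset.range n, sqrtHalf ^ (n - j) * A.indicator 1 (x + unitVec j) := m1.add m2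
  unfold cylMajorant
  rw [lintegral_add_left m12, lintegral_add_left m1, lintegral_const_mul _ hi,
    lintegral_indicator_one hA, lintegral_finsetSum _ fun j _ => (hi' j).const_mul _,
    lintegral_const_mul _ (Finset.measurable_fun_sum _ fun k _ => m3 k),
    lintegral_finsetSum _ fun k _ => m3 k]
  have s2 : ∑ j ∈ Finset.range n,
      ∫⁻ x, sqrtHalf ^ (n - j) * A.indicator (1 : G → ℝ≥0∞) (x + unitVec j) ∂haar ≤
        sqrtHalfSum * haar A := by
    simp_rw [lintegral_const_mul _ (hi' _), e1]
    rw [← Finset.sum_mul]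
    gcongr
    exact sum_sqrtHalf_pow_sub_le n (Finset.range_mono (Nat.le_succ n))
  have s3 : ∀ k ∈ Finset.range n, ∫⁻ x, ∑ j ∈ Finset.range (k + 1),
      sqrtHalf ^ (k - j) * cylAvg k (A.indicator 1) (x + unitVec j) ∂haar ≤
        sqrtHalfSum * haar A := by
    intro k _
    rw [lintegral_finsetSum _ fun j _ => (hc k j).const_mul _]
    simp_rw [lintegral_const_mul _ (hc k _), e2]
    rw [← Finset.sum_mul]
    gcongr
    exact sum_sqrtHalf_pow_sub_le k subset_rfl
  have s4 : (↑(n + 1) : ℝ≥0∞)⁻¹ * ∑ k ∈ Finset.range n, ∫⁻ x, ∑ j ∈ Finset.range (k + 1),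
      sqrtHalf ^ (k - j) * cylAvg k (A.indicator 1) (x + unitVec j) ∂haar ≤
        sqrtHalfSum * haar A := by
    calc _ ≤ (↑(n + 1) : ℝ≥0∞)⁻¹ * (↑(n + 1) * (sqrtHalfSum * haar A)) := by
          gcongr
          refine (Finset.sum_le_sum s3).trans ?_
          rw [Finset.sum_const, Finset.card_range, nsmul_eq_mul]
          gcongr
          exact_mod_cast Nat.le_succ n
      _ = _ := by
          rw [← mul_assoc, ENNReal.inv_mul_cancel (by simp) (ENNReal.natCast_ne_top _), one_mul]
  calc _ ≤ sqrtHalfSum * haar A + sqrtHalfSum * haar A + sqrtHalfSum * haar A := by gcongr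
    _ = _ := by ring

/-- The smallest union of dyadic intervals of rank `n` containing `{f_{n+1} > t}`. -/
def predictableLevelSet (f : ℕ → G → ℝ≥0∞) (t : ℝ≥0∞) (n : ℕ) : Set G :=
  {x | t < f (n + 1) x} ∪ {x | t < f (n + 1) (x + unitVec n)}

/-! ### Stopping an adapted sequence at its level sets -/

section

variable {f : ℕ → G → ℝ≥0∞}

/-- A point `y` of `I_n(x)` agrees through coordinate `n` with either `x` or `x + unitVec n`; in the
second case the two sets of the union exchange roles. -/
theorem isCylinderSet_predictableLevelSet
    (hf : ∀ n x y, y ∈ dyadicInterval n x → f n y = f n x) (t : ℝ≥0∞) (n : ℕ) :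
    IsCylinderSet n (predictableLevelSet f t n) := by
  intro x y hy
  have hsucc : ∀ u v : G, v ∈ dyadicInterval n u → v n = u n → f (n + 1) v = f (n + 1) u := by
    intro u v huv hn
    refine hf _ _ _ fun i hi => ?_
    rcases Nat.lt_succ_iff_lt_or_eq.mp hi with h | rfl
    exacts [huv i h, hn]
  have hx := add_unitVec_mem_dyadicInterval le_rfl (n := n) x
  have hy' := add_unitVec_mem_dyadicInterval le_rfl (n := n) y
  have hyx : y + unitVec n ∈ dyadicInterval n x := dyadicInterval_eq_of_mem hy ▸ hy'
  simp only [predictableLevelSet, Set.mem_union, Set.mem_ofPred_eq]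
  have hz : ∀ a b : ZMod 2, a = b ∨ a = b + 1 := by decide
  rcases hz (y n) (x n) with h | h
  · rw [hsucc x y hy h, hsucc (x + unitVec n) (y + unitVec n)]
    · rwa [dyadicInterval_eq_of_mem hx]
    · simp [h]
  · rw [hsucc (x + unitVec n) y, hsucc x (y + unitVec n) hyx, or_comm]
    · rw [add_unitVec_self, h, add_assoc, show (1 : ZMod 2) + 1 = 0 by decide, add_zero]
    · rwa [dyadicInterval_eq_of_mem hx]
    · rw [add_unitVec_self, h]

theorem measurableSet_predictableLevelSet (hfm : ∀ n, Measurable (f n)) (t : ℝ≥0∞) (n : ℕ) :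
    MeasurableSet (predictableLevelSet f t n) :=
  (measurableSet_lt measurable_const (hfm _)).union
    (measurableSet_lt measurable_const ((hfm _).comp (measurable_add_unitVec n)))

/-- Each stopped set is invariant under translation by `unitVec n`, and is covered by its part in
`{f_{n+1} > t}` and the translate of that part; hence the factor 2. These parts are disjoint and lie
in `{sup f > t}`. -/
theorem tsum_haar_disjointed_le (hf : ∀ n x y, y ∈ dyadicInterval n x → f n y = f n x)
    (hfm : ∀ n, Measurable (f n)) (t : ℝ≥0∞) :
    ∑' n, haar (disjointed (predictableLevelSet f t) n) ≤ 2 * haar {x | t < ⨆ n, f n x} := by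
  set A := disjointed (predictableLevelSet f t) with hA
  have hAm : ∀ n, MeasurableSet (A n) :=
    fun n => MeasurableSet.disjointed (measurableSet_predictableLevelSet hfm t) n
  have hAc := IsCylinderSet.disjointed (isCylinderSet_predictableLevelSet hf t)
  set V : ℕ → Set G := fun n => {x | t < f (n + 1) x}
  have hVm : ∀ n, MeasurableSet (V n) := fun n => measurableSet_lt measurable_const (hfm _)
  have h1 : ∀ n, haar (A n) ≤ 2 * haar (A n ∩ V n) := by
    intro n
    have hsub : A n ⊆ (A n ∩ V n) ∪ (fun x => x + unitVec n) ⁻¹' (A n ∩ V n) := by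
      intro x hx
      rcases disjointed_subset _ _ hx with h | h
      · exact Or.inl ⟨hx, h⟩
      · exact Or.inr ⟨(hAc n x _ (add_unitVec_mem_dyadicInterval le_rfl x)).mpr hx, h⟩
    refine (measure_mono hsub).trans ((measure_union_le _ _).trans_eq ?_)
    rw [(measurePreserving_add_unitVec n).measure_preimage
      ((hAm n).inter (hVm n)).nullMeasurableSet, two_mul]
  have hdisj : Pairwise (Function.onFun Disjoint fun n => A n ∩ V n) := fun i j hij =>
    (disjoint_disjointed (predictableLevelSet f t) hij).mono Set.inter_subset_left
      Set.inter_subset_left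
  calc _ ≤ ∑' n, 2 * haar (A n ∩ V n) := ENNReal.tsum_le_tsum h1
    _ = 2 * haar (⋃ n, A n ∩ V n) := by
        rw [ENNReal.tsum_mul_left, measure_iUnion hdisj fun n => (hAm n).inter (hVm n)]
    _ ≤ _ := by
        gcongr
        refine Set.iUnion_subset fun n x hx => ?_
        exact lt_of_lt_of_le hx.2 (le_iSup (fun n => f n x) (n + 1))

/-- The part of `disjointed (predictableLevelSet f t)` of rank less than `m`. -/
noncomputable def stoppedBefore (f : ℕ → G → ℝ≥0∞) (t : ℝ≥0∞) (m n : ℕ) : Set G :=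
  if n < m then disjointed (predictableLevelSet f t) n else ∅

theorem exists_mem_stoppedBefore {t : ℝ≥0∞} {m : ℕ} (hm : 1 ≤ m) {x : G} (h : t < f m x) :
    ∃ n, x ∈ stoppedBefore f t m n := by
  obtain ⟨l, rfl⟩ : ∃ l, m = l + 1 := ⟨m - 1, by omega⟩
  -- With `m = l + 1`, the point already lies in the predictable set of rank `l`, so its first
  -- covering rank is strictly below `m`.
  have hx : x ∈ partialSups (predictableLevelSet f t) l :=
    le_partialSups (predictableLevelSet f t) l (Or.inl h)
  rw [← biUnion_range_succ_disjointed] at hx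
  simp only [Set.mem_iUnion] at hx
  obtain ⟨n, hn, hx⟩ := hx
  refine ⟨n, ?_⟩
  rwa [stoppedBefore, if_pos (Finset.mem_range.mp hn)]

theorem le_tsum_stoppedBefore {m : ℕ} (hm : 1 ≤ m) {x : G} (hx : f m x ≠ ∞) :
    f m x ≤ ∑' j : ℤ, ((2 : ℝ≥0∞) ^ (j + 1)) ^ 2 *
      ∑' n, (stoppedBefore f ((2 ^ j) ^ 2) m n).indicator 1 x := by
  rcases eq_or_ne (f m x) 0 with h0 | h0
  · rw [h0]; exact zero_le
  have e : (f m x ^ (1 / 2 : ℝ)) ^ 2 = f m x := by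
    rw [← ENNReal.rpow_natCast, ← ENNReal.rpow_mul]
    norm_num
  -- A single dyadic level of `√(f_m x)` suffices. Levels are squares so that the later square root
  -- leaves the weight `2^{j+1}`.
  obtain ⟨j, hj1, hj2⟩ := ENNReal.exists_mem_Ioc_zpow (x := f m x ^ (1 / 2 : ℝ)) (y := 2)
    (by simp [h0]) (by simp [hx]) ENNReal.one_lt_two ENNReal.ofNat_ne_top
  have h1 : ((2 : ℝ≥0∞) ^ j) ^ 2 < f m x := by
    rw [← e]; exact ENNReal.pow_lt_pow_left two_ne_zero hj1
  obtain ⟨n, hn⟩ := exists_mem_stoppedBefore hm h1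
  calc f m x = (f m x ^ (1 / 2 : ℝ)) ^ 2 := e.symm
    _ ≤ (2 ^ (j + 1)) ^ 2 := by gcongr
    _ = (2 ^ (j + 1)) ^ 2 * (stoppedBefore f ((2 ^ j) ^ 2) m n).indicator 1 x := by
        simp [hn]
    _ ≤ (2 ^ (j + 1)) ^ 2 * ∑' n, (stoppedBefore f ((2 ^ j) ^ 2) m n).indicator 1 x := by
        gcongr
        exact ENNReal.le_tsum n
    _ ≤ _ := ENNReal.le_tsum (f := fun j : ℤ => ((2 : ℝ≥0∞) ^ (j + 1)) ^ 2 *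
      ∑' n, (stoppedBefore f ((2 ^ j) ^ 2) m n).indicator 1 x) j

/-- A majorant of the square root of all weighted shifted averages of the sequence `f`. -/
noncomputable def levelMajorant (f : ℕ → G → ℝ≥0∞) (x : G) : ℝ≥0∞ :=
  ∑' j : ℤ, (2 : ℝ≥0∞) ^ (j + 1) *
    ∑' n, cylMajorant n (disjointed (predictableLevelSet f ((2 ^ j) ^ 2)) n) x

theorem sqrt_shiftedAvg_le_levelMajorant
    (hf : ∀ n x y, y ∈ dyadicInterval n x → f n y = f n x)
    (hfm : ∀ n, Measurable (f n)) (hft : ∀ n x, f n x ≠ ∞) {m k : ℕ} (hm : 1 ≤ m) (hkm : k ≤ m)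
    (x : G) :
    (((m : ℝ≥0∞) ^ 2)⁻¹ * shiftedAvg m k (f m) x) ^ (1 / 2 : ℝ) ≤ levelMajorant f x := by
  have hAm : ∀ t n, MeasurableSet (disjointed (predictableLevelSet f t) n) :=
    fun t n => MeasurableSet.disjointed (measurableSet_predictableLevelSet hfm t) n
  have hSm : ∀ t n, MeasurableSet (stoppedBefore f t m n) := by
    intro t n
    unfold stoppedBefore
    split_ifs
    exacts [hAm t n, MeasurableSet.empty]
  have hS : ∀ t, Measurable fun y => ∑' n, (stoppedBefore f t m n).indicator (1 : G → ℝ≥0∞) y :=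
    fun t => Measurable.tsum fun n => measurable_indicator_one (hSm t n)
  have hle := shiftedAvg_mono m k (fun y => le_tsum_stoppedBefore hm (hft m y)) x
  rw [shiftedAvg_tsum m k (fun j : ℤ => (hS ((2 ^ j) ^ 2)).const_mul (((2 : ℝ≥0∞) ^ (j + 1)) ^ 2))]
    at hle
  calc _ ≤ (∑' j : ℤ, ((2 : ℝ≥0∞) ^ (j + 1)) ^ 2 * ∑' n, ((m : ℝ≥0∞) ^ 2)⁻¹ *
        shiftedAvg m k ((stoppedBefore f ((2 ^ j) ^ 2) m n).indicator 1) x) ^ (1 / 2 : ℝ) := by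
        refine ENNReal.rpow_le_rpow ?_ (by norm_num)
        refine (mul_le_mul' le_rfl hle).trans_eq ?_
        rw [← ENNReal.tsum_mul_left]
        refine tsum_congr fun j => ?_
        rw [shiftedAvg_const_mul m k _ (hS _), mul_left_comm,
          shiftedAvg_tsum m k fun n => measurable_indicator_one (hSm _ n),
          ENNReal.tsum_mul_left]
    _ ≤ ∑' j : ℤ, (2 : ℝ≥0∞) ^ (j + 1) * ∑' n, (((m : ℝ≥0∞) ^ 2)⁻¹ *
        shiftedAvg m k ((stoppedBefore f ((2 ^ j) ^ 2) m n).indicator 1) x) ^ (1 / 2 : ℝ) := by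
        refine (sqrt_tsum_le _).trans (ENNReal.tsum_le_tsum fun j => ?_)
        rw [ENNReal.mul_rpow_of_nonneg _ _ (by norm_num), sqrt_sq]
        gcongr
        exact sqrt_tsum_le _
    _ ≤ _ := by
        refine ENNReal.tsum_le_tsum fun j => ?_
        gcongr with n
        by_cases hn : n < m
        · rw [stoppedBefore, if_pos hn]
          exact sqrt_shiftedAvg_indicator_le hn hkm
            (IsCylinderSet.disjointed (isCylinderSet_predictableLevelSet hf _) n) (hAm _ n) x
        -- Ranks `n ≥ m` contribute the empty set.
        · rw [stoppedBefore, if_neg hn]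
          simp [shiftedAvg, cylAvg]

/-- The constant is `24 = 3 * 2 * 4`: from `lintegral_cylMajorant_le`, `tsum_haar_disjointed_le` and
the summation over levels. -/
theorem lintegral_levelMajorant_le (hf : ∀ n x y, y ∈ dyadicInterval n x → f n y = f n x)
    (hfm : ∀ n, Measurable (f n)) :
    ∫⁻ x, levelMajorant f x ∂haar ≤
      24 * sqrtHalfSum * ∫⁻ x, (⨆ n, f n x) ^ (1 / 2 : ℝ) ∂haar := by
  have hAm : ∀ t n, MeasurableSet (disjointed (predictableLevelSet f t) n) :=
    fun t n => MeasurableSet.disjointed (measurableSet_predictableLevelSet hfm t) n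
  have hcm : ∀ t, Measurable fun x =>
      ∑' n, cylMajorant n (disjointed (predictableLevelSet f t) n) x :=
    fun t => Measurable.tsum fun n => measurable_cylMajorant n (hAm t n)
  have hsup : Measurable fun x => ⨆ n, f n x := Measurable.iSup hfm
  have hset : ∀ t, MeasurableSet {x | t < ⨆ n, f n x} :=
    fun t => measurableSet_lt measurable_const hsup
  have h1 : ∀ j : ℤ, ∫⁻ x, (2 : ℝ≥0∞) ^ (j + 1) *
      ∑' n, cylMajorant n (disjointed (predictableLevelSet f ((2 ^ j) ^ 2)) n) x ∂haar ≤
        6 * sqrtHalfSum * ∫⁻ x, (2 : ℝ≥0∞) ^ (j + 1) *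
          {x | (2 ^ j) ^ 2 < ⨆ n, f n x}.indicator 1 x ∂haar := by
    intro j
    rw [lintegral_const_mul _ (hcm _),
      lintegral_tsum fun n => (measurable_cylMajorant n (hAm _ n)).aemeasurable,
      lintegral_const_mul _ (measurable_indicator_one (hset _)),
      lintegral_indicator_one (hset _)]
    calc _ ≤ (2 : ℝ≥0∞) ^ (j + 1) * ∑' n, 3 * sqrtHalfSum *
          haar (disjointed (predictableLevelSet f ((2 ^ j) ^ 2)) n) := by
          gcongr with n
          exact lintegral_cylMajorant_le n (hAm _ n)
      _ ≤ (2 : ℝ≥0∞) ^ (j + 1) * (3 * sqrtHalfSum *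
          (2 * haar {x | (2 ^ j) ^ 2 < ⨆ n, f n x})) := by
          rw [ENNReal.tsum_mul_left]
          gcongr
          exact tsum_haar_disjointed_le hf hfm _
      _ = _ := by ring
  unfold levelMajorant
  rw [lintegral_tsum fun j => ((hcm _).const_mul _).aemeasurable]
  calc _ ≤ ∑' j : ℤ, 6 * sqrtHalfSum * ∫⁻ x, (2 : ℝ≥0∞) ^ (j + 1) *
          {x | (2 ^ j) ^ 2 < ⨆ n, f n x}.indicator 1 x ∂haar := ENNReal.tsum_le_tsum h1
    _ = 6 * sqrtHalfSum * ∫⁻ x, ∑' j : ℤ, (2 : ℝ≥0∞) ^ (j + 1) *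
          {x | (2 ^ j) ^ 2 < ⨆ n, f n x}.indicator 1 x ∂haar := by
        rw [ENNReal.tsum_mul_left, lintegral_tsum fun j =>
          ((measurable_indicator_one (hset _)).const_mul _).aemeasurable]
    _ ≤ 6 * sqrtHalfSum * ∫⁻ x, 4 * (⨆ n, f n x) ^ (1 / 2 : ℝ) ∂haar := by
        gcongr with x
        refine le_trans (ENNReal.tsum_le_tsum fun j => ?_)
          (tsum_two_zpow_indicator_le ((⨆ n, f n x) ^ (1 / 2 : ℝ)))
        gcongr
        by_cases h : ((2 : ℝ≥0∞) ^ j) ^ 2 < ⨆ n, f n x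
        · have h' : (2 : ℝ≥0∞) ^ j < (⨆ n, f n x) ^ (1 / 2 : ℝ) := by
            rw [← sqrt_sq (2 ^ j)]
            exact ENNReal.rpow_lt_rpow h (by norm_num)
          rw [Set.indicator_of_mem (a := (⨆ n, f n x) ^ (1 / 2 : ℝ)) h']
          exact Set.indicator_le_self' (fun _ _ => zero_le) _
        · rw [Set.indicator_of_notMem (a := x) h]
          exact zero_le
    _ = _ := by
        rw [lintegral_const_mul _ (hsup.pow_const _)]
        ring

end

/-! ### Dyadic martingales and their Fejér means -/

theorem isCylinderSet_of_measurableSet {n : ℕ} {A : Set G}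
    (hA : MeasurableSet[dyadicFiltration n] A) : IsCylinderSet n A := by
  refine MeasurableSpace.generateFrom_induction (Set.range (dyadicInterval n))
    (fun A _ => IsCylinderSet n A) ?_ ?_ ?_ ?_ A hA
  · rintro _ ⟨z, rfl⟩ _ x y hy
    rw [mem_dyadicInterval_comm, dyadicInterval_eq_of_mem hy, ← mem_dyadicInterval_comm]
  · exact fun _ _ _ => Iff.rfl
  · exact fun t _ ht x y hy => not_congr (ht x y hy)
  · intro s _ hs x y hy
    simp only [Set.mem_iUnion]
    exact exists_congr fun i => hs i x y hy

theorem IsCylinderSet.measurableSet_dyadicFiltration {n : ℕ} {A : Set G}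
    (hA : IsCylinderSet n A) : MeasurableSet[dyadicFiltration n] A := by
  classical
  -- Prefixes of length `n`, extended by zero, index the rank `n` intervals finitely, so the union
  -- is measurable.
  set e : (Fin n → ZMod 2) → G := fun p i => if h : i < n then p ⟨i, h⟩ else 0
  have h : A = ⋃ p : Fin n → ZMod 2, ⋃ _ : e p ∈ A, dyadicInterval n (e p) := by
    ext x
    simp only [Set.mem_iUnion, exists_prop]
    constructor
    · intro hx
      have hmem : e (fun i => x i) ∈ dyadicInterval n x := fun i hi => by simp [e, hi]
      exact ⟨fun i => x i, (hA _ _ hmem).mpr hx, mem_dyadicInterval_comm.mp hmem⟩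
    · rintro ⟨p, hp, hx⟩
      exact (hA _ _ hx).mpr hp
  rw [h]
  exact MeasurableSet.iUnion fun p => MeasurableSet.iUnion fun _ =>
    MeasurableSpace.measurableSet_generateFrom ⟨_, rfl⟩

theorem apply_eq_of_stronglyMeasurable {n : ℕ} {g : G → ℝ}
    (hg : StronglyMeasurable[dyadicFiltration n] g) {x y : G} (hy : y ∈ dyadicInterval n x) :
    g y = g x :=
  (isCylinderSet_of_measurableSet (hg.measurable (MeasurableSet.singleton (g x))) x y hy).mpr rfl

theorem stronglyMeasurable_of_apply_eq {n : ℕ} {g : G → ℝ}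
    (hg : ∀ x y, y ∈ dyadicInterval n x → g y = g x) :
    StronglyMeasurable[dyadicFiltration n] g := by
  have hm : Measurable[dyadicFiltration n] g := fun s _ =>
    IsCylinderSet.measurableSet_dyadicFiltration fun x y hy => by
      simp only [Set.mem_preimage, hg x y hy]
  exact hm.stronglyMeasurable

theorem stronglyMeasurable_walsh {i m : ℕ} (hi : i < 2 ^ m) :
    StronglyMeasurable[dyadicFiltration m] (walsh i) := by
  refine stronglyMeasurable_of_apply_eq fun x y hy => ?_
  rw [walsh_eq_prod_range hi, walsh_eq_prod_range hi]
  refine Finset.prod_congr rfl fun k hk => ?_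
  rw [rademacher, rademacher, hy k (Finset.mem_range.mp hk)]

theorem measurable_walsh (i : ℕ) : Measurable (walsh i) :=
  ((stronglyMeasurable_walsh Nat.lt_two_pow_self).mono (dyadicFiltration.le i)).measurable

/-! ### Fejér means as integrals of one `F_m` against kernels -/

section

variable {F : ℕ → G → ℝ}

theorem integrable_mul_walsh {g : G → ℝ} (hg : Integrable g haar) (i : ℕ) :
    Integrable (fun x => g x * walsh i x) haar :=
  hg.mul_bdd (c := 1) (measurable_walsh i).aestronglyMeasurable
    (ae_of_all _ fun x => (abs_walsh i x).le)

/-- For `i < 2^m` the function `w_i` is `ζ_m`-measurable and can be pulled out of the conditional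
expectation. The sequence defining the Fourier coefficient is therefore constant from `m` on. -/
theorem integral_mul_walsh_eq (hF : Martingale F dyadicFiltration haar) {i m n : ℕ}
    (hi : i < 2 ^ m) (hmn : m ≤ n) :
    ∫ x, F n x * walsh i x ∂haar = ∫ x, F m x * walsh i x ∂haar := by
  have h1 := condExp_mul_of_stronglyMeasurable_right (stronglyMeasurable_walsh hi)
    (integrable_mul_walsh (hF.integrable n) i) (hF.integrable n)
  have h2 : haar[F n * walsh i | dyadicFiltration m] =ᵐ[haar] F m * walsh i := by
    filter_upwards [h1, hF.2 m n hmn] with x h1 h2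
    rw [h1, Pi.mul_apply, Pi.mul_apply, h2]
  calc ∫ x, F n x * walsh i x ∂haar
      = ∫ x, (haar[F n * walsh i | dyadicFiltration m]) x ∂haar :=
        (integral_condExp (dyadicFiltration.le m)).symm
    _ = _ := integral_congr_ae h2

theorem fourierCoeff_eq (hF : Martingale F dyadicFiltration haar) {i m : ℕ} (hi : i < 2 ^ m) :
    fourierCoeff F i = ∫ x, F m x * walsh i x ∂haar := by
  refine Tendsto.limUnder_eq (tendsto_const_nhds.congr' ?_)
  filter_upwards [eventually_ge_atTop m] with n hn
  exact (integral_mul_walsh_eq hF hi hn).symm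

theorem sum_partialSum_eq (N : ℕ) (x : G) :
    ∑ k ∈ Finset.Icc 1 N, partialSum F k x =
      ∑ i ∈ Finset.range N, ((N : ℝ) - i) * (fourierCoeff F i * walsh i x) := by
  induction N with
  | zero => simp
  | succ N ih =>
    rw [Finset.sum_Icc_succ_top (by omega), ih, partialSum, Finset.sum_range_succ,
      Finset.sum_range_succ _ N, ← add_assoc, ← Finset.sum_add_distrib]
    refine congrArg₂ (· + ·) (Finset.sum_congr rfl fun i _ => ?_) ?_ <;> push_cast <;> ring

theorem fejerMean_eq_integral (hF : Martingale F dyadicFiltration haar) {N m : ℕ}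
    (hN : N ≤ 2 ^ m) (x : G) :
    fejerMean F N x = (1 / (N : ℝ)) *
      ∫ y, F m y * ∑ i ∈ Finset.range N, ((N : ℝ) - i) * walsh i (x + y) ∂haar := by
  rw [fejerMean, sum_partialSum_eq]
  congr 1
  simp_rw [Finset.mul_sum]
  have e : ∀ i y, F m y * (((N : ℝ) - i) * walsh i (x + y)) =
      ((N : ℝ) - i) * walsh i x * (F m y * walsh i y) := fun i y => by rw [walsh_add]; ring
  simp_rw [e]
  rw [integral_finsetSum _ fun i _ => (integrable_mul_walsh (hF.integrable m) i).const_mul _]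
  refine Finset.sum_congr rfl fun i hi => ?_
  rw [integral_const_mul, fourierCoeff_eq hF ((Finset.mem_range.mp hi).trans_le hN)]
  ring

theorem ofReal_dirichletKernel (k : ℕ) (x y : G) :
    ENNReal.ofReal (dirichletKernel k (x + y)) = 2 ^ k * (dyadicInterval k x).indicator 1 y := by
  have h : (∀ i < k, (x + y) i = 0) ↔ y ∈ dyadicInterval k x := by
    have hz : ∀ a b : ZMod 2, a + b = 0 ↔ b = a := by decide
    exact forall₂_congr fun i _ => hz (x i) (y i)
  rw [dirichletKernel_eq]
  by_cases hy : y ∈ dyadicInterval k x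
  · rw [if_pos (h.mpr hy), Set.indicator_of_mem hy, ENNReal.ofReal_pow (by norm_num)]
    simp
  · rw [if_neg (mt h.mp hy), Set.indicator_of_notMem hy]
    simp

theorem lintegral_mul_fejerMajorant {m k : ℕ} (hkm : k ≤ m) {g : G → ℝ≥0∞} (hg : Measurable g)
    (x : G) :
    ∫⁻ y, g y * ENNReal.ofReal (fejerMajorant k (x + y)) ∂haar = 2 ^ m * shiftedAvg m k g x := by
  have h1 : ∀ y, g y * ENNReal.ofReal (fejerMajorant k (x + y)) =
      ∑ j ∈ Finset.range (k + 1),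
        2 ^ j * 2 ^ k * (dyadicInterval k (x + unitVec j)).indicator g y := by
    intro y
    rw [fejerMajorant, ENNReal.ofReal_sum_of_nonneg fun j _ =>
      mul_nonneg (by positivity) (dirichletKernel_nonneg _ _), Finset.mul_sum]
    refine Finset.sum_congr rfl fun j _ => ?_
    rw [ENNReal.ofReal_mul (by positivity), add_right_comm, ofReal_dirichletKernel,
      ENNReal.ofReal_pow (by norm_num)]
    by_cases hy : y ∈ dyadicInterval k (x + unitVec j)
    · simp [hy]; ring
    · simp [hy]
  have hm : ∀ j, Measurable ((dyadicInterval k (x + unitVec j)).indicator g) :=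
    fun j => hg.indicator (measurableSet_dyadicInterval _ _)
  simp_rw [h1]
  rw [lintegral_finsetSum _ fun j _ => (hm j).const_mul _, shiftedAvg, Finset.mul_sum]
  refine Finset.sum_congr rfl fun j hj => ?_
  have hj' := Finset.mem_range.mp hj
  rw [lintegral_const_mul _ (hm j), mul_assoc, ← cylAvg_eq_lintegral_indicator, ← mul_assoc]
  congr 1
  conv_rhs => rw [← Nat.add_sub_cancel' (by omega : j ≤ m), pow_add, add_tsub_cancel_left]
  rw [mul_assoc, two_pow_mul_inv_two_pow, mul_one]

theorem measurable_of_martingale (hF : Martingale F dyadicFiltration haar) (n : ℕ) :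
    Measurable (F n) :=
  ((hF.1 n).mono (dyadicFiltration.le n)).measurable

theorem two_pow_le_betaNum {s k : ℕ} (hk : k < s) : 2 ^ s ≤ betaNum s k := by
  rw [betaNum_eq hk, pow_succ]
  have : 2 ^ k ≤ 2 ^ s := Nat.pow_le_pow_right two_pos hk.le
  omega

theorem ofReal_abs_fejerMean_le (hF : Martingale F dyadicFiltration haar) {s k : ℕ}
    (hk : k < s) (x : G) :
    ENNReal.ofReal |fejerMean F (betaNum s k) x| ≤
      2 * (shiftedAvg (s + 1) (s + 1) (fun y => ENNReal.ofReal |F (s + 1) y|) x +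
        shiftedAvg (s + 1) k (fun y => ENNReal.ofReal |F (s + 1) y|) x) := by
  set m := s + 1 with hm
  set f : G → ℝ≥0∞ := fun y => ENNReal.ofReal |F m y| with hf
  have hfm : Measurable f := (measurable_of_martingale hF m).abs.ennreal_ofReal
  have hkm : k ≤ m := by omega
  set N := betaNum s k with hN
  have hNe : N = 2 ^ m - 2 ^ k := betaNum_eq hk
  have hle : 2 ^ k ≤ 2 ^ m := Nat.pow_le_pow_right two_pos hkm
  have hNr : (N : ℝ) = 2 ^ m - 2 ^ k := by
    rw [hNe, Nat.cast_sub hle]; push_cast; rfl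
  have hNs : (2 : ℝ) ^ s ≤ N := by exact_mod_cast two_pow_le_betaNum hk
  have hN0 : (0 : ℝ) < N := lt_of_lt_of_le (by positivity) hNs
  -- The factor 2 arises from `N ≥ 2^s = 2^m / 2`.
  have hinv : ENNReal.ofReal (1 / (N : ℝ)) ≤ 2 * 2⁻¹ ^ m := by
    have h1 : 1 / (N : ℝ) ≤ 2⁻¹ ^ s := by
      rw [inv_pow, one_div]
      exact inv_anti₀ (by positivity) hNs
    refine (ENNReal.ofReal_le_ofReal h1).trans_eq ?_
    rw [ENNReal.ofReal_pow (by norm_num), ENNReal.ofReal_inv_of_pos two_pos, hm, pow_succ',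
      ← mul_assoc, ENNReal.ofReal_ofNat, ENNReal.mul_inv_cancel two_ne_zero ENNReal.ofNat_ne_top,
      one_mul]
  have hker : ∀ y, ‖F m y * ∑ i ∈ Finset.range N, ((N : ℝ) - i) * walsh i (x + y)‖ₑ ≤
      f y * ENNReal.ofReal (fejerMajorant m (x + y)) +
        f y * ENNReal.ofReal (fejerMajorant k (x + y)) := by
    intro y
    rw [enorm_mul, ← mul_add, Real.enorm_eq_ofReal_abs, Real.enorm_eq_ofReal_abs,
      ← ENNReal.ofReal_add ((fejerKernel_nonneg _ _).trans (fejerKernel_le_majorant _ _))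
        ((fejerKernel_nonneg _ _).trans (fejerKernel_le_majorant _ _))]
    gcongr
    rw [hNr, hNe]
    exact abs_fejerKernel_two_pow_sub_le hkm (x + y)
  have hmeas : Measurable fun y => f y * ENNReal.ofReal (fejerMajorant m (x + y)) := by
    have h1 : Measurable fun y => fejerMajorant m (x + y) := by
      have : ∀ y, fejerMajorant m (x + y) = ∑ j ∈ Finset.range (m + 1), 2 ^ j *
          ∑ i ∈ Finset.range (2 ^ m), walsh i x * walsh i y * walsh i (unitVec j) := by
        intro y
        simp only [fejerMajorant, dirichletKernel, walsh_add]
      simp_rw [this]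
      exact Finset.measurable_fun_sum _ fun j _ => Measurable.const_mul
        (Finset.measurable_fun_sum _ fun i _ =>
          ((measurable_walsh i).const_mul _).mul_const _) _
    exact hfm.mul h1.ennreal_ofReal
  rw [fejerMean_eq_integral hF (m := m) (hNe.le.trans (Nat.sub_le _ _)) x, abs_mul, abs_of_pos (by positivity),
    ENNReal.ofReal_mul (by positivity), ← Real.enorm_eq_ofReal_abs]
  calc _ ≤ (2 * 2⁻¹ ^ m) * ∫⁻ y, (f y * ENNReal.ofReal (fejerMajorant m (x + y)) +
        f y * ENNReal.ofReal (fejerMajorant k (x + y))) ∂haar := by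
        gcongr
        exact (enorm_integral_le_lintegral_enorm _).trans (lintegral_mono hker)
    _ = 2 * (2 ^ m * 2⁻¹ ^ m) * (shiftedAvg m m f x + shiftedAvg m k f x) := by
        rw [lintegral_add_left hmeas, lintegral_mul_fejerMajorant le_rfl hfm,
          lintegral_mul_fejerMajorant hkm hfm]
        ring
    _ = _ := by rw [two_pow_mul_inv_two_pow, mul_one]

/-- Here `s ≥ 1`, so `s log 2 ≥ s / 2 ≥ (s + 1) / 4`. -/
theorem sq_div_le_log_betaNum_sq {s k : ℕ} (hk : k < s) :
    ((s + 1 : ℕ) : ℝ) ^ 2 / 16 ≤ Real.log (betaNum s k) ^ 2 := by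
  have h1 : (2 : ℝ) ^ s ≤ betaNum s k := by exact_mod_cast two_pow_le_betaNum hk
  have h2 : s * Real.log 2 ≤ Real.log (betaNum s k) := by
    rw [← Real.log_pow]
    exact Real.log_le_log (by positivity) h1
  have h3 : (1 : ℝ) ≤ s := by exact_mod_cast (by omega : 1 ≤ s)
  have h4 : ((s + 1 : ℕ) : ℝ) / 4 ≤ Real.log (betaNum s k) := by
    push_cast
    nlinarith [Real.log_two_gt_d9]
  calc ((s + 1 : ℕ) : ℝ) ^ 2 / 16 = (((s + 1 : ℕ) : ℝ) / 4) ^ 2 := by ring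
    _ ≤ _ := by gcongr

theorem restrictedMaximal_le (hF : Martingale F dyadicFiltration haar) (x : G) :
    restrictedMaximal F x ≤ (12 * levelMajorant (fun n y => ENNReal.ofReal |F n y|) x) ^ 2 := by
  set f : ℕ → G → ℝ≥0∞ := fun n y => ENNReal.ofReal |F n y| with hf
  refine iSup_le fun s => iSup_le fun k => iSup_le fun hk => ?_
  have hfm : ∀ n, Measurable (f n) :=
    fun n => (measurable_of_martingale hF n).abs.ennreal_ofReal
  have hfc : ∀ n x y, y ∈ dyadicInterval n x → f n y = f n x := fun n x y hy => by
    simp only [hf, apply_eq_of_stronglyMeasurable (hF.1 n) hy]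
  have hmaj : ∀ k ≤ s + 1,
      (((s + 1 : ℕ) : ℝ≥0∞) ^ 2)⁻¹ * shiftedAvg (s + 1) k (f (s + 1)) x ≤
        levelMajorant f x ^ 2 := by
    intro k hk
    have := sqrt_shiftedAvg_le_levelMajorant hfc hfm (fun _ _ => ENNReal.ofReal_ne_top)
      (by omega : 1 ≤ s + 1) hk x
    calc _ = ((((s + 1 : ℕ) : ℝ≥0∞) ^ 2)⁻¹ * shiftedAvg (s + 1) k (f (s + 1)) x) ^
          ((1 / 2 : ℝ) * 2) := by norm_num
      _ ≤ _ := by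
        rw [ENNReal.rpow_mul, ENNReal.rpow_ofNat]
        gcongr
  have hs0 : (0 : ℝ) < ((s + 1 : ℕ) : ℝ) := by positivity
  have hlog : |fejerMean F (betaNum s k) x| / Real.log (betaNum s k) ^ 2 ≤
      16 * ((((s + 1 : ℕ) : ℝ) ^ 2)⁻¹ * |fejerMean F (betaNum s k) x|) := by
    calc _ ≤ |fejerMean F (betaNum s k) x| / (((s + 1 : ℕ) : ℝ) ^ 2 / 16) := by
          gcongr
          exact sq_div_le_log_betaNum_sq hk
      _ = _ := by field_simp
  refine (ENNReal.ofReal_le_ofReal hlog).trans ?_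
  rw [ENNReal.ofReal_mul (by norm_num), ENNReal.ofReal_mul (by positivity),
    ENNReal.ofReal_inv_of_pos (by positivity), ENNReal.ofReal_pow hs0.le, ENNReal.ofReal_natCast,
    ENNReal.ofReal_ofNat]
  calc _ ≤ 16 * ((((s + 1 : ℕ) : ℝ≥0∞) ^ 2)⁻¹ *
        (2 * (shiftedAvg (s + 1) (s + 1) (f (s + 1)) x +
          shiftedAvg (s + 1) k (f (s + 1)) x))) := by
        gcongr
        exact ofReal_abs_fejerMean_le hF hk x
    _ = 32 * ((((s + 1 : ℕ) : ℝ≥0∞) ^ 2)⁻¹ * shiftedAvg (s + 1) (s + 1) (f (s + 1)) x +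
        (((s + 1 : ℕ) : ℝ≥0∞) ^ 2)⁻¹ * shiftedAvg (s + 1) k (f (s + 1)) x) := by ring
    _ ≤ 32 * (levelMajorant f x ^ 2 + levelMajorant f x ^ 2) := by
        gcongr
        exacts [hmaj _ le_rfl, hmaj _ (by omega)]
    _ = 64 * levelMajorant f x ^ 2 := by ring
    -- Rounded up to `144 = 12^2`, a perfect square (64 is one too), to match the stated factor 12.
    _ ≤ 144 * levelMajorant f x ^ 2 := by gcongr; norm_num
    _ = _ := by ring

theorem measurable_restrictedMaximal : Measurable (restrictedMaximal F) := by
  refine Measurable.iSup fun s => Measurable.iSup fun k => Measurable.iSup fun _ => ?_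
  refine (Measurable.div_const ?_ _).ennreal_ofReal
  refine Measurable.abs (Measurable.const_mul ?_ _)
  exact Finset.measurable_fun_sum _ fun n _ => Finset.measurable_fun_sum _ fun i _ =>
    (measurable_walsh i).const_mul _

theorem eLpNorm_half (g : G → ℝ≥0∞) :
    eLpNorm g (1 / 2) haar = (∫⁻ x, g x ^ (1 / 2 : ℝ) ∂haar) ^ 2 := by
  have h : ((1 / 2 : ℝ≥0∞)).toReal = 1 / 2 := by simp
  rw [eLpNorm_eq_lintegral_rpow_enorm_toReal (by simp) (by simp), h]
  simp

theorem eLpNorm_restrictedMaximal_le (hF : Martingale F dyadicFiltration haar) :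
    eLpNorm (restrictedMaximal F) (1 / 2) haar ≤
      (288 * sqrtHalfSum) ^ 2 * hardyNorm (1 / 2) F := by
  have hfm : ∀ n, Measurable fun y => ENNReal.ofReal |F n y| :=
    fun n => (measurable_of_martingale hF n).abs.ennreal_ofReal
  have hfc : ∀ n x y, y ∈ dyadicInterval n x →
      ENNReal.ofReal |F n y| = ENNReal.ofReal |F n x| := fun n x y hy => by
    rw [apply_eq_of_stronglyMeasurable (hF.1 n) hy]
  rw [hardyNorm, eLpNorm_half, eLpNorm_half, ← mul_pow]
  gcongr
  calc _ ≤ ∫⁻ x, 12 * levelMajorant (fun n y => ENNReal.ofReal |F n y|) x ∂haar := by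
        refine lintegral_mono fun x => ?_
        rw [← sqrt_sq (12 * _)]
        exact ENNReal.rpow_le_rpow (restrictedMaximal_le hF x) (by norm_num)
    _ = 12 * ∫⁻ x, levelMajorant (fun n y => ENNReal.ofReal |F n y|) x ∂haar :=
        lintegral_const_mul' _ _ ENNReal.ofNat_ne_top
    _ ≤ 12 * (24 * sqrtHalfSum * ∫⁻ x, (⨆ n, ENNReal.ofReal |F n x|) ^ (1 / 2 : ℝ) ∂haar) := by
        gcongr
        exact lintegral_levelMajorant_le hfc hfm
    _ = 288 * sqrtHalfSum * ∫⁻ x, maximalFunction F x ^ (1 / 2 : ℝ) ∂haar := by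
        unfold maximalFunction
        ring

end

end WalshFejer

theorem corollary4 :
    ∃ C : NNReal, ∀ F : ℕ → WalshFejer.G → ℝ, WalshFejer.MemHardy (1 / 2) F →
      MeasureTheory.MemLp (WalshFejer.restrictedMaximal F) (1 / 2) WalshFejer.haar ∧
      MeasureTheory.eLpNorm (WalshFejer.restrictedMaximal F) (1 / 2) WalshFejer.haar
        ≤ (C : ENNReal) * WalshFejer.hardyNorm (1 / 2) F := by
  have hC : (288 * WalshFejer.sqrtHalfSum) ^ 2 ≠ ∞ :=
    ENNReal.pow_ne_top (ENNReal.mul_ne_top ENNReal.ofNat_ne_top WalshFejer.sqrtHalfSum_ne_top)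
  refine ⟨((288 * WalshFejer.sqrtHalfSum) ^ 2).toNNReal, fun F hF => ?_⟩
  have h := WalshFejer.eLpNorm_restrictedMaximal_le hF.martingale
  rw [ENNReal.coe_toNNReal hC]
  exact ⟨⟨WalshFejer.measurable_restrictedMaximal.aestronglyMeasurable,
    h.trans_lt (ENNReal.mul_lt_top hC.lt_top hF.norm_lt_top)⟩, h⟩
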